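/- **Setting.** A stochastic objective on $\mathbb{R}^d$ is $L(w)=\mathbb{E}_{z\sim\mathcal D}[\ell(w;z)]$ for a probability distribution $\mathcal D$ and a loss $\ell$; $L^*=\min_w L(w)$. The loss is *convex and $H$-smooth* if for all $z,u,w$ $$\ell(u;z)+\langle\nabla\ell(u;z),w-u\rangle\le \ell(w;z)\le \ell(u;z)+\langle\nabla\ell(u;z),w-u\rangle+\tfrac H2\|w-u\|^2 .$$ A *minibatch first-order algorithm with $T$ rounds of size $b$* chooses, possibly with internal randomness, query points $w_1,\dots,w_T\in\mathbb{R}^d$ one after the other; after choosing $w_t$ it receives $\frac1b\sum_{i=1}^b\nabla\ell(w_t;z_t^i)$ with fresh i.i.d. samples $z_t^1,\dots,z_t^b\sim\mathcal D$. Each query point and the final output $\hat w$ are arbitrary (measurable) functions of the internal randomness and of the stochastic gradients received before. Below $T,b\ge1$ are integers. **(a) Convex lower bound.** There is a universal constant $c>0$ such that for all $H,B>0$, $\sigma_*\ge0$ and $b,T$ there is a dimension $d$ such that for every minibatch first-order algorithm on $\mathbb{R}^d$ with $T$ rounds of size $b$ there is a stochastic objective on $\mathbb{R}^d$ for which $\ell$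 is convex and $H$-smooth, $L$ has a minimizer $w^*$ with $\|w^*\|<B$ and $\mathbb{E}\|\nabla\ell(w^*;z)\|^2\le\sigma_*^2$, and $$\mathbb{E}L(\hat w)-L^*\ \ge\ c\left(\frac{HB^2}{T^2}+\frac{HB^2}{bT}+\min\left\{\frac{\sigma_*B}{\sqrt{bT}},\,HB^2\right\}\right).$$ (For $\sigma_*\le HB\sqrt{bT}$ the last term is $\sigma_*B/\sqrt{bT}$.) **(b) Strongly convex lower bound.** For every $\kappa_0>1$ there are constants $c,c'>0$, depending only on $\kappa_0$, such that for all $\lambda>0$, $H\ge\kappa_0\lambda$, $\Delta>0$, $\sigma_*\ge0$ and $b,T$ there is a dimension $d$ such that for every minibatch first-order algorithm on $\mathbb{R}^d$ with $T$ rounds of size $b$ there is a stochastic objective on $\mathbb{R}^d$ for which $\ell$ is convex and $H$-smooth, $L$ is $\lambda$-strongly convex with minimizer $w^*$, $L(0)-L^*\le\Delta$, $\mathbb{E}\|\nabla\ell(w^*;z)\|^2\le\sigma_*^2$, and $$\mathbb{E}L(\hat w)-L^*\ \ge\ c\left(\Delta\exp\left(-\frac{c'\sqrt\lambda\,T}{\sqrt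 H}\right)+\Delta\cdot\mathbf 1\left[bT\le\frac{H}{2\lambda}\right]+\min\left\{\frac{\sigma_*^2}{\lambda bT},\,\Delta\right\}\right).$$ **(c) No acceleration with $b=1$, even if $\sigma_*=0$.** For every $C>0$ there is $T_0$ such that for all $T\ge T_0$ and $H,B>0$ there is a dimension $d$ such that for every algorithm on $\mathbb{R}^d$ with $T$ rounds of size $b=1$ some objective as in (a) with $\sigma_*=0$ has $\mathbb{E}L(\hat w)-L^*>C\,HB^2/T^2$. Likewise, for all $C,a>0$ there is $\kappa_1$ such that for all $\lambda,\Delta>0$ and $H\ge\kappa_1\lambda$ there are $T\ge1$ and a dimension $d$ such that for every algorithm on $\mathbb{R}^d$ with $T$ rounds of size $b=1$ some objective as in (b) with $\sigma_*=0$ has $\mathbb{E}L(\hat w)-L^*>C\Delta\exp(-a\sqrt\lambda\,T/\sqrt H)$. -/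

import Mathlib

open MeasureTheory Set

universe u

/-- Euclidean space of dimension `d`. -/
abbrev Euc (d : ℕ) : Type := EuclideanSpace ℝ (Fin d)

/-- `f` is differentiable, convex and `H`-smooth: it lies above its tangents, and below the tangents
plus the quadratic `H / 2 * ‖w - u‖ ^ 2`. -/
def IsConvexSmooth {d : ℕ} (H : ℝ) (f : Euc d → ℝ) : Prop :=
  Differentiable ℝ f ∧ ∀ u w : Euc d,
    f u + inner ℝ (gradient f u) (w - u) ≤ f w ∧
    f w ≤ f u + inner ℝ (gradient f u) (w - u) + H / 2 * ‖w - u‖ ^ 2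

/-- A stochastic optimization problem on `ℝ^d`: a probability distribution of samples `z` and a loss
`ℓ(w; z)` whose expectation exists at each `w`. -/
structure StochasticObjective (d : ℕ) where
  /-- the type of samples -/
  Sample : Type
  /-- its measurable structure -/
  [measurableSpace : MeasurableSpace Sample]
  /-- the distribution of the samples -/
  dist : Measure Sample
  [isProbabilityMeasure : IsProbabilityMeasure dist]
  /-- the loss `ℓ(w; z)` -/
  loss : Euc d → Sample → ℝ
  measurable_loss : Measurable (Function.uncurry loss)
  integrable_loss : ∀ w, Integrable (loss w) dist

attribute [instance] StochasticObjective.measurableSpace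
attribute [instance] StochasticObjective.isProbabilityMeasure

namespace StochasticObjective

variable {d : ℕ} (P : StochasticObjective d)

/-- The expected loss `L(w) = 𝔼 ℓ(w; z)`. -/
noncomputable def risk (w : Euc d) : ℝ := ∫ z, P.loss w z ∂P.dist

/-- The optimal value `L* = inf_w L(w)`. -/
noncomputable def optValue : ℝ := ⨅ w, P.risk w

/-- The gradient `∇ℓ(w; z)` with respect to `w`. -/
noncomputable def lossGrad (w : Euc d) (z : P.Sample) : Euc d := gradient (fun u => P.loss u z) w

/-- The minibatch stochastic gradient `(1/b) ∑ i, ∇ℓ(w; z i)`. -/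
noncomputable def minibatchGrad {b : ℕ} (w : Euc d) (z : Fin b → P.Sample) : Euc d :=
  (b : ℝ)⁻¹ • ∑ i, P.lossGrad w (z i)

/-- `𝔼 ‖∇ℓ(w; z)‖² ≤ σ²`. -/
def GradVarianceLE (σ : ℝ) (w : Euc d) : Prop :=
  Integrable (fun z => ‖P.lossGrad w z‖ ^ 2) P.dist ∧ ∫ z, ‖P.lossGrad w z‖ ^ 2 ∂P.dist ≤ σ ^ 2

/-- The losses are convex and `H`-smooth, and `L` has a minimizer of norm less than `B` at which the
stochastic gradient has second moment at most `σ²`. -/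
def InConvexClass (H B σ : ℝ) : Prop :=
  (∀ z, IsConvexSmooth H (fun w => P.loss w z)) ∧
  ∃ wstar : Euc d, IsMinOn P.risk univ wstar ∧ ‖wstar‖ < B ∧ P.GradVarianceLE σ wstar

/-- The losses are convex and `H`-smooth, `L` is `lam`-strongly convex, `L(0) - L* ≤ Δ`, and at the
minimizer of `L` the stochastic gradient has second moment at most `σ²`. -/
def InStronglyConvexClass (H lam Δ σ : ℝ) : Prop :=
  (∀ z, IsConvexSmooth H (fun w => P.loss w z)) ∧
  StrongConvexOn univ lam P.risk ∧
  ∃ wstar : Euc d, IsMinOn P.risk univ wstar ∧ P.risk 0 - P.risk wstar ≤ Δ ∧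
    P.GradVarianceLE σ wstar

end StochasticObjective

/-- A (possibly randomized) algorithm on `ℝ^d` that asks for `T` stochastic gradients one after the
other. Each query point, and the output, is an arbitrary measurable function of the internal
randomness and of the stochastic gradients received so far. -/
structure FirstOrderAlgorithm (d T : ℕ) where
  /-- the space of the internal randomness -/
  Seed : Type u
  /-- its measurable structure -/
  [measurableSpace : MeasurableSpace Seed]
  /-- the distribution of the internal randomness -/
  seedDist : Measure Seed
  [isProbabilityMeasure : IsProbabilityMeasure seedDist]
  /-- the query point of round `t`, given the answers of the rounds before -/
  query : (t : Fin T) → Seed → (Fin t → Euc d) → Euc d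
  measurable_query : ∀ t, Measurable (Function.uncurry (query t))
  /-- the output, given all answers -/
  output : Seed → (Fin T → Euc d) → Euc d
  measurable_output : Measurable (Function.uncurry output)

attribute [instance] FirstOrderAlgorithm.measurableSpace
attribute [instance] FirstOrderAlgorithm.isProbabilityMeasure

namespace FirstOrderAlgorithm

variable {d T : ℕ} (A : FirstOrderAlgorithm.{u} d T) (P : StochasticObjective d) {b : ℕ}

/-- The minibatch gradients received in the first `t` rounds, when `z k` is the minibatch of
round `k`. -/
noncomputable def answers (s : A.Seed) (z : Fin T → Fin b → P.Sample) :
    (t : ℕ) → t ≤ T → Fin t → Euc d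
  | 0, _ => Fin.elim0
  | t + 1, ht =>
    let prev := answers s z t (Nat.le_of_succ_le ht)
    Fin.snoc (α := fun _ => Euc d) prev
      (P.minibatchGrad (A.query ⟨t, ht⟩ s prev) (z ⟨t, ht⟩))

/-- The point returned by the algorithm. -/
noncomputable def result (s : A.Seed) (z : Fin T → Fin b → P.Sample) : Euc d :=
  A.output s (A.answers P s z T le_rfl)

/-- The expected error `𝔼 L(ŵ) - L*`, with values in `[0, ∞]`, when each round uses a fresh
minibatch of `b` i.i.d. samples, independent of the internal randomness. -/
noncomputable def expectedError (b : ℕ) : ENNReal :=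
  ∫⁻ ω : A.Seed × (Fin T → Fin b → P.Sample),
    ENNReal.ofReal (P.risk (A.result P ω.1 ω.2) - P.optValue)
    ∂(A.seedDist.prod (Measure.pi fun _ : Fin T => Measure.pi fun _ : Fin b => P.dist))

end FirstOrderAlgorithm

/-- `f` lies above its tangents with slope `g`, and below them plus `H / 2 * ‖w - u‖ ^ 2`. -/
def HasSmoothGrad {d : ℕ} (H : ℝ) (f : Euc d → ℝ) (g : Euc d → Euc d) : Prop :=
  ∀ u w : Euc d, f u + inner ℝ (g u) (w - u) ≤ f w ∧
    f w ≤ f u + inner ℝ (g u) (w - u) + H / 2 * ‖w - u‖ ^ 2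

namespace HasSmoothGrad

variable {d : ℕ} {H H' : ℝ} {f f' : Euc d → ℝ} {g g' : Euc d → Euc d}

theorem hasGradientAt (h : HasSmoothGrad H f g) (u : Euc d) : HasGradientAt f (g u) u := by
  rw [hasGradientAt_iff_isLittleO]
  have hO : (fun x' => f x' - f u - inner ℝ (g u) (x' - u)) =O[nhds u]
      fun x' => ‖x' - u‖ ^ 2 := by
    refine Asymptotics.IsBigO.of_bound (H / 2) (Filter.Eventually.of_forall fun w => ?_)
    have := h u w
    rw [Real.norm_eq_abs, abs_of_nonneg (by linarith), Real.norm_of_nonneg (by positivity)]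
    linarith
  refine hO.trans_isLittleO ?_
  have h2 := Asymptotics.isLittleO_norm_pow_id (E' := Euc d) (n := 2) one_lt_two
  have hT : Filter.Tendsto (fun x' : Euc d => x' - u) (nhds u) (nhds 0) := by
    have : Filter.Tendsto (fun x' : Euc d => x' - u) (nhds u) (nhds (u - u)) :=
      Filter.Tendsto.sub_const Filter.tendsto_id u
    simpa using this
  exact h2.comp_tendsto hT

theorem gradient_eq (h : HasSmoothGrad H f g) (u : Euc d) : gradient f u = g u :=
  (h.hasGradientAt u).gradient

theorem differentiable (h : HasSmoothGrad H f g) : Differentiable ℝ f :=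
  fun u => (h.hasGradientAt u).differentiableAt

theorem isConvexSmooth (h : HasSmoothGrad H f g) : IsConvexSmooth H f :=
  ⟨h.differentiable, fun u w => by rw [h.gradient_eq]; exact h u w⟩

theorem mono (h : HasSmoothGrad H f g) (hH : H ≤ H') : HasSmoothGrad H' f g := by
  intro u w
  refine ⟨(h u w).1, (h u w).2.trans ?_⟩
  gcongr

theorem add (h : HasSmoothGrad H f g) (h' : HasSmoothGrad H' f' g') :
    HasSmoothGrad (H + H') (fun w => f w + f' w) (fun w => g w + g' w) := by
  intro u w
  have h1 := h u w
  have h2 := h' u w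
  simp only [inner_add_left]
  constructor
  · linarith [h1.1, h2.1]
  · have : (H + H') / 2 * ‖w - u‖ ^ 2 = H / 2 * ‖w - u‖ ^ 2 + H' / 2 * ‖w - u‖ ^ 2 := by ring
    linarith [h1.2, h2.2]

theorem convexOn (h : HasSmoothGrad H f g) : ConvexOn ℝ univ f := by
  refine ⟨convex_univ, fun x _ y _ a b ha hb hab => ?_⟩
  have h1 := (h (a • x + b • y) x).1
  have h2 := (h (a • x + b • y) y).1
  have e : a * inner ℝ (g (a • x + b • y)) (x - (a • x + b • y))
      + b * inner ℝ (g (a • x + b • y)) (y - (a • x + b • y)) = 0 := by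
    rw [← real_inner_smul_right, ← real_inner_smul_right, ← inner_add_right]
    have : a • (x - (a • x + b • y)) + b • (y - (a • x + b • y)) = 0 := by
      obtain rfl : b = 1 - a := by linarith
      module
    rw [this, inner_zero_right]
  simp only [smul_eq_mul]
  have e3 : f (a • x + b • y) = a * f (a • x + b • y) + b * f (a • x + b • y) := by
    rw [← add_mul, hab, one_mul]
  nlinarith [mul_le_mul_of_nonneg_left h1 ha, mul_le_mul_of_nonneg_left h2 hb]

end HasSmoothGrad

theorem hasSmoothGrad_half_norm_sq {d : ℕ} {l : ℝ} (hl : 0 ≤ l) :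
    HasSmoothGrad l (fun w : Euc d => l / 2 * ‖w‖ ^ 2) (fun w => l • w) := by
  intro u w
  have e : ‖w‖ ^ 2 = ‖u‖ ^ 2 + 2 * inner ℝ u (w - u) + ‖w - u‖ ^ 2 := by
    rw [← norm_add_sq_real]; simp
  simp only [real_inner_smul_left, e]
  constructor
  · have := mul_nonneg (half_pos (a := (1:ℝ)) one_pos).le (mul_nonneg hl (sq_nonneg ‖w - u‖))
    linarith
  · apply le_of_eq; ring

theorem hasSmoothGrad_inner {d : ℕ} (v : Euc d) :
    HasSmoothGrad 0 (fun w : Euc d => inner ℝ v w) (fun _ => v) := by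
  intro u w
  simp [inner_sub_right]

/-- The function `M * √(R² + ‖w‖²) - K`, with slope at most `M`. -/
theorem hasSmoothGrad_sqrt {d : ℕ} {M R K : ℝ} (hM : 0 ≤ M) (hR : 0 < R) :
    HasSmoothGrad (M / R) (fun w : Euc d => M * √(R ^ 2 + ‖w‖ ^ 2) - K)
      (fun w => (M / √(R ^ 2 + ‖w‖ ^ 2)) • w) := by
  intro u w
  set a := √(R ^ 2 + ‖u‖ ^ 2) with ha
  set b := √(R ^ 2 + ‖w‖ ^ 2) with hb
  have ha2 : a ^ 2 = R ^ 2 + ‖u‖ ^ 2 := Real.sq_sqrt (by positivity)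
  have hb2 : b ^ 2 = R ^ 2 + ‖w‖ ^ 2 := Real.sq_sqrt (by positivity)
  have haR : R ≤ a := Real.le_sqrt_of_sq_le (by nlinarith [sq_nonneg ‖u‖])
  have hbR : R ≤ b := Real.le_sqrt_of_sq_le (by nlinarith [sq_nonneg ‖w‖])
  have ha0 : 0 < a := hR.trans_le haR
  have hb0 : 0 < b := hR.trans_le hbR
  have e : ‖w‖ ^ 2 = ‖u‖ ^ 2 + 2 * inner ℝ u (w - u) + ‖w - u‖ ^ 2 := by
    rw [← norm_add_sq_real]; simp
  have hcs : inner ℝ u w ≤ ‖u‖ * ‖w‖ := real_inner_le_norm u w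
  have hi : inner ℝ u (w - u) = inner ℝ u w - ‖u‖ ^ 2 := by
    rw [inner_sub_right, real_inner_self_eq_norm_sq]
  simp only [real_inner_smul_left]
  constructor
  · have key : a ^ 2 + inner ℝ u (w - u) ≤ a * b := by
      have : (R ^ 2 + ‖u‖ * ‖w‖) ^ 2 ≤ (a * b) ^ 2 := by
        rw [mul_pow, ha2, hb2]
        nlinarith [sq_nonneg (R * (‖u‖ - ‖w‖))]
      have := abs_le_of_sq_le_sq' this (by positivity)
      rw [hi]; linarith [this.2]
    have : M / a * inner ℝ u (w - u) = M * (inner ℝ u (w - u) / a) := by ring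
    rw [this]
    have : a + inner ℝ u (w - u) / a ≤ b := by
      rw [← sub_nonneg]
      have : b - (a + inner ℝ u (w - u) / a) = (a * b - (a ^ 2 + inner ℝ u (w - u))) / a := by
        field_simp
      rw [this]
      exact div_nonneg (by linarith) ha0.le
    nlinarith [mul_le_mul_of_nonneg_left this hM]
  · have h1 : b ≤ a + inner ℝ u (w - u) / a + ‖w - u‖ ^ 2 / (2 * a) := by
      have : a + inner ℝ u (w - u) / a + ‖w - u‖ ^ 2 / (2 * a) = (a ^ 2 + b ^ 2) / (2 * a) := by
        rw [hb2, e]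
        field_simp
        rw [ha2]; ring
      rw [this, le_div_iff₀ (by positivity)]
      nlinarith [sq_nonneg (a - b)]
    have h2 : ‖w - u‖ ^ 2 / (2 * a) ≤ ‖w - u‖ ^ 2 / (2 * R) := by gcongr
    have h3 := mul_le_mul_of_nonneg_left (h1.trans (add_le_add_right h2 _)) hM
    have : M * (a + inner ℝ u (w - u) / a + ‖w - u‖ ^ 2 / (2 * R))
      = M * a + M / a * inner ℝ u (w - u) + M / R / 2 * ‖w - u‖ ^ 2 := by
      field_simp
    linarith

theorem sqrt_add_norm_sq_lipschitz {d : ℕ} (R : ℝ) (u w : Euc d) :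
    |√(R ^ 2 + ‖u‖ ^ 2) - √(R ^ 2 + ‖w‖ ^ 2)| ≤ ‖u - w‖ := by
  have key : ∀ u w : Euc d, √(R ^ 2 + ‖u‖ ^ 2) - √(R ^ 2 + ‖w‖ ^ 2) ≤ ‖u - w‖ := by
    intro u w
    have h1 : ‖u‖ ≤ ‖w‖ + ‖u - w‖ := by
      have := norm_add_le w (u - w)
      simpa using this
    have h2 : ‖w‖ ≤ √(R ^ 2 + ‖w‖ ^ 2) := Real.le_sqrt_of_sq_le (by nlinarith [sq_nonneg R])
    have h3 : (√(R ^ 2 + ‖w‖ ^ 2)) ^ 2 = R ^ 2 + ‖w‖ ^ 2 := Real.sq_sqrt (by positivity)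
    rw [sub_le_iff_le_add]
    apply Real.sqrt_le_iff.2
    refine ⟨by positivity, ?_⟩
    nlinarith [norm_nonneg u, norm_nonneg w, norm_nonneg (u - w),
      mul_le_mul_of_nonneg_left h2 (norm_nonneg (u - w))]
  rw [abs_le]
  constructor
  · have := key w u
    rw [norm_sub_rev] at this
    linarith
  · exact key u w

/-- The projection of `s` to the interval `[0, τ]`. -/
noncomputable def clip (τ s : ℝ) : ℝ := max 0 (min s τ)

/-- The convex function with value `0` at `0` and derivative `clip τ`. -/
noncomputable def softRelu (τ s : ℝ) : ℝ := clip τ s * s - clip τ s ^ 2 / 2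

section clip

variable {τ s s' : ℝ}

theorem clip_nonneg : 0 ≤ clip τ s := le_max_left _ _

theorem clip_le (hτ : 0 ≤ τ) : clip τ s ≤ τ := max_le hτ (min_le_right _ _)

theorem clip_of_nonpos (hs : s ≤ 0) : clip τ s = 0 := by
  simp [clip, hs]

theorem clip_of_mem (h0 : 0 ≤ s) (h1 : s ≤ τ) : clip τ s = s := by
  simp [clip, h0, h1]

theorem clip_of_ge (hτ : 0 ≤ τ) (h1 : τ ≤ s) : clip τ s = τ := by
  simp [clip, hτ, h1]

theorem softRelu_of_nonpos (hs : s ≤ 0) : softRelu τ s = 0 := by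
  simp [softRelu, clip_of_nonpos hs]

theorem softRelu_of_ge (hτ : 0 ≤ τ) (h1 : τ ≤ s) : softRelu τ s = τ * s - τ ^ 2 / 2 := by
  rw [softRelu, clip_of_ge hτ h1]

theorem softRelu_tangent_le (hτ : 0 ≤ τ) :
    softRelu τ s + clip τ s * (s' - s) ≤ softRelu τ s' := by
  rcases le_total s 0 with h | h <;> rcases le_total s' 0 with h' | h' <;>
  rcases le_total s τ with k | k <;> rcases le_total s' τ with k' | k' <;>
  simp only [softRelu, clip_of_nonpos, clip_of_mem, clip_of_ge, *] <;>
  nlinarith [sq_nonneg (s - s')]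

theorem softRelu_le_tangent_add (hτ : 0 ≤ τ) :
    softRelu τ s' ≤ softRelu τ s + clip τ s * (s' - s) + (s' - s) ^ 2 / 2 := by
  rcases le_total s 0 with h | h <;> rcases le_total s' 0 with h' | h' <;>
  rcases le_total s τ with k | k <;> rcases le_total s' τ with k' | k' <;>
  simp only [softRelu, clip_of_nonpos, clip_of_mem, clip_of_ge, *] <;>
  nlinarith [sq_nonneg (s - s'), mul_nonneg (sub_nonneg.2 k) (sub_nonneg.2 k'),
    sq_nonneg (s - τ), sq_nonneg (s' - τ)]

theorem softRelu_lipschitz (hτ : 0 ≤ τ) : |softRelu τ s' - softRelu τ s| ≤ τ * |s' - s| := by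
  have key : ∀ s s' : ℝ, softRelu τ s' - softRelu τ s ≤ τ * |s' - s| := by
    intro s s'
    have h1 := softRelu_tangent_le (s := s') (s' := s) hτ
    have h2 : clip τ s' * (s' - s) ≤ τ * |s' - s| :=
      (mul_le_mul_of_nonneg_left (le_abs_self _) clip_nonneg).trans
        (mul_le_mul_of_nonneg_right (clip_le hτ) (abs_nonneg _))
    linarith
  rw [abs_le]
  constructor
  · have := key s' s
    rw [abs_sub_comm] at this
    linarith
  · exact key s s'

end clip

/-- Glueing of `h` (where `h` exceeds `W` by `τ`, up to a constant) and `W` (where `h ≤ W`). -/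
noncomputable def glue {d : ℕ} (τ : ℝ) (h W : Euc d → ℝ) (w : Euc d) : ℝ :=
  W w + softRelu τ (h w - W w) / τ

/-- The gradient of `glue`. -/
noncomputable def glueGrad {d : ℕ} (τ : ℝ) (h W : Euc d → ℝ) (gh gW : Euc d → Euc d)
    (w : Euc d) : Euc d :=
  (1 - clip τ (h w - W w) / τ) • gW w + (clip τ (h w - W w) / τ) • gh w

theorem hasSmoothGrad_glue {d : ℕ} {τ G Hh HW : ℝ} {h W : Euc d → ℝ} {gh gW : Euc d → Euc d}
    (hτ : 0 < τ) (hh : HasSmoothGrad Hh h gh) (hW : HasSmoothGrad HW W gW) (hH : HW ≤ Hh)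
    (hG : ∀ u w, |(h w - W w) - (h u - W u)| ≤ G * ‖w - u‖) :
    HasSmoothGrad (Hh + G ^ 2 / τ) (glue τ h W) (glueGrad τ h W gh gW) := by
  intro u w
  set su := h u - W u with hsu
  set sw := h w - W w with hsw
  set p := clip τ su with hp
  have hθ0 : 0 ≤ p / τ := div_nonneg clip_nonneg hτ.le
  have hθ1 : p / τ ≤ 1 := (div_le_one hτ).2 (clip_le hτ.le)
  set θ := p / τ with hθ
  have hpθ : p = θ * τ := by rw [hθ]; field_simp
  have e1 : inner ℝ (glueGrad τ h W gh gW u) (w - u)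
      = (1 - θ) * inner ℝ (gW u) (w - u) + θ * inner ℝ (gh u) (w - u) := by
    simp only [glueGrad, inner_add_left, real_inner_smul_left]
    rfl
  have l1 : softRelu τ su + p * (sw - su) ≤ softRelu τ sw := softRelu_tangent_le hτ.le
  have l2 : softRelu τ sw ≤ softRelu τ su + p * (sw - su) + (sw - su) ^ 2 / 2 :=
    softRelu_le_tangent_add hτ.le
  have d1 : softRelu τ su / τ + θ * (sw - su) ≤ softRelu τ sw / τ := by
    have := div_le_div_of_nonneg_right l1 hτ.le
    have e : (softRelu τ su + p * (sw - su)) / τ = softRelu τ su / τ + θ * (sw - su) := by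
      rw [hθ]; ring
    linarith
  have d2 : softRelu τ sw / τ ≤ softRelu τ su / τ + θ * (sw - su) + (sw - su) ^ 2 / (2 * τ) := by
    have := div_le_div_of_nonneg_right l2 hτ.le
    have e : (softRelu τ su + p * (sw - su) + (sw - su) ^ 2 / 2) / τ
        = softRelu τ su / τ + θ * (sw - su) + (sw - su) ^ 2 / (2 * τ) := by
      rw [hθ]; field_simp
    linarith
  have a1 := hh u w
  have a2 := hW u w
  have g1 : glue τ h W u = W u + softRelu τ su / τ := rfl
  have g2 : glue τ h W w = W w + softRelu τ sw / τ := rfl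
  rw [e1, g1, g2]
  have hθ1' : 0 ≤ 1 - θ := by linarith
  constructor
  · have b1 := mul_le_mul_of_nonneg_left a1.1 hθ0
    have b2 := mul_le_mul_of_nonneg_left a2.1 hθ1'
    have : θ * (sw - su) = θ * h w - θ * W w - θ * h u + θ * W u := by rw [hsw, hsu]; ring
    linarith
  · have b1 := mul_le_mul_of_nonneg_left a1.2 hθ0
    have b2 := mul_le_mul_of_nonneg_left (a2.2.trans
      (add_le_add_right (mul_le_mul_of_nonneg_right (by linarith : HW / 2 ≤ Hh / 2)
        (sq_nonneg ‖w - u‖)) _)) hθ1'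
    have b3 : (sw - su) ^ 2 / (2 * τ) ≤ G ^ 2 / τ / 2 * ‖w - u‖ ^ 2 := by
      have h1 : (sw - su) ^ 2 ≤ (G * ‖w - u‖) ^ 2 := by
        rw [← sq_abs (sw - su)]
        exact pow_le_pow_left₀ (abs_nonneg _) (hG u w) 2
      calc (sw - su) ^ 2 / (2 * τ) ≤ (G * ‖w - u‖) ^ 2 / (2 * τ) := by gcongr
        _ = _ := by field_simp
    have : θ * (sw - su) = θ * h w - θ * W w - θ * h u + θ * W u := by rw [hsw, hsu]; ring
    have e9 : (Hh + G ^ 2 / τ) / 2 * ‖w - u‖ ^ 2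
      = Hh / 2 * ‖w - u‖ ^ 2 + G ^ 2 / τ / 2 * ‖w - u‖ ^ 2 := by ring
    linarith

namespace StochasticObjective

variable {d : ℕ} {P : StochasticObjective d}

theorem optValue_eq {w : Euc d} (hw : IsMinOn P.risk univ w) : P.optValue = P.risk w :=
  le_antisymm (ciInf_le ⟨P.risk w, by rintro _ ⟨v, rfl⟩; exact hw (mem_univ v)⟩ w)
    (le_ciInf fun v => hw (mem_univ v))

theorem minibatchGrad_eq_of_forall {b : ℕ} (hb : 0 < b) {w v : Euc d} {z : Fin b → P.Sample}
    (h : ∀ i, P.lossGrad w (z i) = v) : P.minibatchGrad w z = v := by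
  have : (b : ℝ) ≠ 0 := by positivity
  simp only [minibatchGrad, h, Finset.sum_const, Finset.card_univ, Fintype.card_fin]
  rw [← Nat.cast_smul_eq_nsmul ℝ, smul_smul, inv_mul_cancel₀ this, one_smul]

theorem InStronglyConvexClass.inConvexClass {H lam Δ σ B : ℝ} (hlam : 0 < lam) (hB : 0 < B)
    (h : P.InStronglyConvexClass H lam Δ σ) (hΔ : Δ < lam / 2 * B ^ 2) :
    P.InConvexClass H B σ := by
  obtain ⟨h1, h2, w, hw, h3, h4⟩ := h
  refine ⟨h1, w, hw, ?_, h4⟩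
  have key : lam / 2 * ‖w‖ ^ 2 ≤ P.risk 0 - P.risk w := by
    by_contra! hlt
    have hpos : 0 < ‖w‖ := by
      rcases (norm_nonneg w).eq_or_lt with h0 | h0
      · have := hw (mem_univ 0)
        simp only [mem_ofPred_eq] at this
        rw [← h0] at hlt
        norm_num at hlt
        linarith
      · exact h0
    have hQ : 0 < lam / 2 * ‖w‖ ^ 2 := by positivity
    set Q := lam / 2 * ‖w‖ ^ 2 with hQd
    set D := P.risk 0 - P.risk w with hD
    have hD0 : 0 ≤ D := by
      have := hw (mem_univ 0)
      simp only [mem_ofPred_eq] at this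
      linarith
    set a := (Q - D) / (2 * Q) with ha
    have ha0 : 0 < a := div_pos (by linarith) (by positivity)
    have ha1 : a ≤ 1 / 2 := by rw [ha, div_le_div_iff₀ (by positivity) (by positivity)]; linarith
    have h5 := h2.2 (mem_univ (0 : Euc d)) (mem_univ w) ha0.le (by linarith : (0:ℝ) ≤ 1 - a)
      (by ring)
    have h6 := hw (mem_univ (a • (0 : Euc d) + (1 - a) • w))
    simp only [mem_ofPred_eq] at h6
    simp only [smul_eq_mul, zero_sub, norm_neg] at h5
    have h7 : 0 ≤ a * (D - (1 - a) * Q) := by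
      have : a * (D - (1 - a) * Q)
        = a * P.risk 0 + (1 - a) * P.risk w - a * (1 - a) * (lam / 2 * ‖w‖ ^ 2) - P.risk w := by
        rw [hD, hQd]; ring
      rw [this]
      linarith
    have h8 : a * Q = (Q - D) / 2 := by rw [ha]; field_simp
    nlinarith
  have : ‖w‖ ^ 2 < B ^ 2 := by
    have : lam / 2 * ‖w‖ ^ 2 < lam / 2 * B ^ 2 := by linarith
    exact lt_of_mul_lt_mul_left this (by positivity)
  exact lt_of_pow_lt_pow_left₀ 2 hB.le this

end StochasticObjective

namespace FirstOrderAlgorithm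

variable {d T : ℕ} (A : FirstOrderAlgorithm.{u} d T)

/-- The answers in the first `t` rounds when the query `w` of round `k` is answered by `r k w`. -/
noncomputable def transcript (s : A.Seed) (r : ℕ → Euc d → Euc d) :
    (t : ℕ) → t ≤ T → Fin t → Euc d
  | 0, _ => Fin.elim0
  | t + 1, ht =>
    let prev := transcript s r t (Nat.le_of_succ_le ht)
    Fin.snoc (α := fun _ => Euc d) prev (r t (A.query ⟨t, ht⟩ s prev))

/-- The query point of round `k < T`, or the output for `k = T`, when the query `w` of round `k` is
answered by `r k w`. -/
noncomputable def point (s : A.Seed) (r : ℕ → Euc d → Euc d) (k : ℕ) : Euc d :=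
  if h : k < T then A.query ⟨k, h⟩ s (A.transcript s r k h.le)
  else A.output s (A.transcript s r T le_rfl)

variable {A}

theorem transcript_congr {s : A.Seed} {r r' : ℕ → Euc d → Euc d} :
    ∀ {t : ℕ} (ht : t ≤ T), (∀ k < t, r k (A.point s r k) = r' k (A.point s r k)) →
    A.transcript s r t ht = A.transcript s r' t ht
  | 0, _, _ => rfl
  | t + 1, ht, h => by
    have ih := transcript_congr (Nat.le_of_succ_le ht) fun k hk => h k (hk.trans t.lt_succ_self)
    have h1 := h t t.lt_succ_self
    rw [point, dif_pos (show t < T from ht)] at h1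
    simp only [transcript]
    rw [h1, ih]

theorem point_congr {s : A.Seed} {r r' : ℕ → Euc d → Euc d} {t : ℕ} (ht : t ≤ T)
    (h : ∀ k < t, r k (A.point s r k) = r' k (A.point s r k)) :
    A.point s r t = A.point s r' t := by
  unfold point
  split_ifs with h1
  · rw [transcript_congr h1.le h]
  · obtain rfl : t = T := le_antisymm ht (not_lt.1 h1)
    rw [transcript_congr le_rfl h]

variable {P : StochasticObjective d} {b : ℕ}

theorem answers_eq_transcript {s : A.Seed} {z : Fin T → Fin b → P.Sample} {G : Euc d → Euc d}
    (h : ∀ t w, P.minibatchGrad w (z t) = G w) : ∀ (t : ℕ) (ht : t ≤ T),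
    A.answers P s z t ht = A.transcript s (fun _ => G) t ht
  | 0, _ => rfl
  | t + 1, ht => by
    simp only [transcript, answers]
    rw [answers_eq_transcript h t, h]

theorem result_eq_point {s : A.Seed} {z : Fin T → Fin b → P.Sample} {G : Euc d → Euc d}
    (h : ∀ t w, P.minibatchGrad w (z t) = G w) :
    A.result P s z = A.point s (fun _ => G) T := by
  rw [result, point, dif_neg (lt_irrefl T), answers_eq_transcript h]

theorem measurable_answers (hP : Measurable (Function.uncurry P.lossGrad)) :
    ∀ (t : ℕ) (ht : t ≤ T),
    Measurable fun ω : A.Seed × (Fin T → Fin b → P.Sample) => A.answers P ω.1 ω.2 t ht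
  | 0, _ => measurable_pi_iff.2 fun i => i.elim0
  | t + 1, ht => by
    have ih := measurable_answers hP t (Nat.le_of_succ_le ht)
    rw [measurable_pi_iff]
    intro i
    simp only [answers]
    refine Fin.lastCases ?_ (fun j => ?_) i
    · simp only [Fin.snoc_last]
      have hq : Measurable fun ω : A.Seed × (Fin T → Fin b → P.Sample) =>
          A.query ⟨t, ht⟩ ω.1 (A.answers P ω.1 ω.2 t (Nat.le_of_succ_le ht)) :=
        (A.measurable_query ⟨t, ht⟩).comp (measurable_fst.prodMk ih)
      unfold StochasticObjective.minibatchGrad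
      refine Measurable.const_smul (M := ℝ) (Finset.measurable_sum (M := Euc d) _ fun j _ => ?_) _
      have hz : Measurable fun ω : A.Seed × (Fin T → Fin b → P.Sample) => ω.2 ⟨t, ht⟩ j := by
        fun_prop
      exact hP.comp (hq.prodMk hz)
    · simp only [Fin.snoc_castSucc]
      exact measurable_pi_iff.1 ih j

theorem measurable_result (hP : Measurable (Function.uncurry P.lossGrad)) :
    Measurable fun ω : A.Seed × (Fin T → Fin b → P.Sample) => A.result P ω.1 ω.2 :=
  A.measurable_output.comp (measurable_fst.prodMk (measurable_answers hP T le_rfl))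

end FirstOrderAlgorithm

/-- If the average of finitely many functions is at least `e` on `S`, then one of them has integral
at least `e * μ S`. -/
theorem exists_mul_measure_le_lintegral {Ω κ : Type*} [MeasurableSpace Ω] [Fintype κ] [Nonempty κ]
    {μ : Measure Ω} {S : Set Ω} {f : κ → Ω → ENNReal}
    (hf : ∀ k, Measurable (f k)) {e : ENNReal} (h : ∀ ω ∈ S, Fintype.card κ * e ≤ ∑ k, f k ω) :
    ∃ k, e * μ S ≤ ∫⁻ ω, f k ω ∂μ := by
  by_contra! hlt
  have h1 : ∑ k, ∫⁻ ω, f k ω ∂μ < ∑ _k : κ, e * μ S :=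
    ENNReal.sum_lt_sum_of_nonempty Finset.univ_nonempty fun k _ => hlt k
  rw [← lintegral_finsetSum _ fun k _ => hf k, Finset.sum_const, Finset.card_univ,
    nsmul_eq_mul] at h1
  have h2 : ∫⁻ _ω in S, Fintype.card κ * e ∂μ ≤ ∫⁻ ω, ∑ k, f k ω ∂μ :=
    (setLIntegral_mono (Finset.measurable_sum _ fun k _ => hf k) h).trans
      (setLIntegral_le_lintegral _ _)
  rw [setLIntegral_const, mul_assoc] at h2
  exact absurd h1 (not_lt.2 h2)

/-- If `f - lam / 2 * ‖·‖²` has a gradient field and `w` is a stationary point of `f`, then `f` grows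
quadratically around `w`. -/
theorem HasSmoothGrad.le_of_stationary {d : ℕ} {H l : ℝ} {f : Euc d → ℝ} {g : Euc d → Euc d}
    (h : HasSmoothGrad H f g) {w : Euc d} (hw : g w + l • w = 0) (x : Euc d) :
    f w + l / 2 * ‖w‖ ^ 2 + l / 2 * ‖x - w‖ ^ 2 ≤ f x + l / 2 * ‖x‖ ^ 2 := by
  have h1 := (h w x).1
  have e : ‖x‖ ^ 2 = ‖w‖ ^ 2 + 2 * inner ℝ w (x - w) + ‖x - w‖ ^ 2 := by
    rw [← norm_add_sq_real]; simp
  rw [eq_neg_of_add_eq_zero_left hw, inner_neg_left, real_inner_smul_left] at h1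
  rw [e]
  linarith

theorem HasSmoothGrad.strongConvexOn {d : ℕ} {H l : ℝ} {f : Euc d → ℝ} {g : Euc d → Euc d}
    (h : HasSmoothGrad H f g) :
    StrongConvexOn univ l (fun w => f w + l / 2 * ‖w‖ ^ 2) := by
  rw [strongConvexOn_iff_convex]
  simpa using h.convexOn

section RareSample

/-- The distribution on `Bool` under which `true` has probability `q`. -/
noncomputable def rareMeasure (q : ℝ) : Measure Bool :=
  ENNReal.ofReal q • Measure.dirac true + ENNReal.ofReal (1 - q) • Measure.dirac false

theorem isProbabilityMeasure_rareMeasure {q : ℝ} (h0 : 0 ≤ q) (h1 : q ≤ 1) :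
    IsProbabilityMeasure (rareMeasure q) := by
  constructor
  simp only [rareMeasure, Measure.add_apply, Measure.smul_apply, measure_univ, smul_eq_mul, mul_one]
  rw [← ENNReal.ofReal_add h0 (by linarith)]
  simp

theorem rareMeasure_false {q : ℝ} : rareMeasure q {false} = ENNReal.ofReal (1 - q) := by
  simp [rareMeasure]

theorem integral_rareMeasure {q : ℝ} (h0 : 0 ≤ q) (h1 : q ≤ 1) (f : Bool → ℝ) :
    ∫ z, f z ∂rareMeasure q = q * f true + (1 - q) * f false := by
  have : IsProbabilityMeasure (rareMeasure q) := isProbabilityMeasure_rareMeasure h0 h1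
  rw [integral_fintype Integrable.of_finite, Fintype.sum_bool]
  have h2 : (rareMeasure q).real {true} = q := by
    simp [rareMeasure, Measure.real, ENNReal.toReal_ofReal h0]
  have h3 : (rareMeasure q).real {false} = 1 - q := by
    simp [rareMeasure, Measure.real, ENNReal.toReal_ofReal (sub_nonneg.2 h1)]
  rw [h2, h3, smul_eq_mul, smul_eq_mul]

variable {d : ℕ}

/-- The sign `±1`. -/
noncomputable def boolSign (s : Bool) : ℝ := if s then 1 else -1

theorem boolSign_sq (s : Bool) : boolSign s ^ 2 = 1 := by cases s <;> norm_num [boolSign]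

/-- The curvature of the loss of sample `z`. -/
noncomputable def rareCurv (h h' : ℝ) (z : Bool) : ℝ := if z then h else h'

/-- The linear coefficient of the loss of sample `z`. -/
noncomputable def rareSlope (a : ℝ) (z : Bool) : ℝ := if z then a else 0

/-- Quadratic losses on the samples `true` of probability `q` and `false`; the loss of `false` does
not depend on the sign `s`. -/
noncomputable def rareObjective (e : Euc d) (h h' a q : ℝ) (h0 : 0 ≤ q) (h1 : q ≤ 1) (s : Bool) :
    StochasticObjective d where
  Sample := Bool
  dist := rareMeasure q
  isProbabilityMeasure := isProbabilityMeasure_rareMeasure h0 h1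
  loss w z := inner ℝ ((-(boolSign s * rareSlope a z)) • e) w + rareCurv h h' z / 2 * ‖w‖ ^ 2
  measurable_loss := by
    refine measurable_from_prod_countable_left fun z => ?_
    simp only [Function.uncurry]
    fun_prop
  integrable_loss w := by
    have : IsProbabilityMeasure (rareMeasure q) := isProbabilityMeasure_rareMeasure h0 h1
    exact Integrable.of_finite

variable {e : Euc d} {h h' a q : ℝ} {h0 : 0 ≤ q} {h1 : q ≤ 1} {s : Bool}

theorem hasSmoothGrad_rareObjective (hh : 0 ≤ h) (hh' : 0 ≤ h') (z : Bool) :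
    HasSmoothGrad (0 + rareCurv h h' z) (fun w => (rareObjective e h h' a q h0 h1 s).loss w z)
      (fun w => (-(boolSign s * rareSlope a z)) • e + rareCurv h h' z • w) := by
  refine (hasSmoothGrad_inner _).add (hasSmoothGrad_half_norm_sq ?_)
  cases z <;> simpa [rareCurv]

theorem lossGrad_rareObjective (hh : 0 ≤ h) (hh' : 0 ≤ h') (w : Euc d) (z : Bool) :
    (rareObjective e h h' a q h0 h1 s).lossGrad w z
      = (-(boolSign s * rareSlope a z)) • e + rareCurv h h' z • w :=
  (hasSmoothGrad_rareObjective hh hh' z).gradient_eq w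

theorem risk_rareObjective (w : Euc d) :
    (rareObjective e h h' a q h0 h1 s).risk w
      = inner ℝ ((-(boolSign s * (q * a))) • e) w + (q * h + (1 - q) * h') / 2 * ‖w‖ ^ 2 := by
  refine (integral_rareMeasure h0 h1 _).trans ?_
  simp only [rareObjective, rareSlope, rareCurv, real_inner_smul_left, if_true]
  simp
  ring

/-- If only rare samples tell two quadratics with opposite minimizers apart, then no algorithm does
well on both. -/
theorem exists_rareObjective {T b : ℕ} (hb : 0 < b) (hT : 0 < T) (A : FirstOrderAlgorithm.{u} d T)
    (he : ‖e‖ = 1) (hh : 0 ≤ h) (hh' : 0 ≤ h') {lam r : ℝ}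
    (hlam : lam ≤ q * h + (1 - q) * h') (hpos : 0 < q * h + (1 - q) * h')
    (hqn : q ≤ 1 / (2 * (b * T))) (hr : q * a = (q * h + (1 - q) * h') * r) :
    ∃ s, StrongConvexOn univ lam (rareObjective e h h' a q h0 h1 s).risk ∧
      IsMinOn (rareObjective e h h' a q h0 h1 s).risk univ ((boolSign s * r) • e) ∧
      (rareObjective e h h' a q h0 h1 s).risk 0
        - (rareObjective e h h' a q h0 h1 s).risk ((boolSign s * r) • e)
        = (q * h + (1 - q) * h') * r ^ 2 / 2 ∧
      ENNReal.ofReal ((q * h + (1 - q) * h') * r ^ 2 / 4)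
        ≤ A.expectedError (rareObjective e h h' a q h0 h1 s) b := by
  set hm := q * h + (1 - q) * h' with hhm
  have hgrow : ∀ (s : Bool) (x : Euc d),
      (rareObjective e h h' a q h0 h1 s).risk ((boolSign s * r) • e)
        + hm / 2 * ‖x - (boolSign s * r) • e‖ ^ 2
        ≤ (rareObjective e h h' a q h0 h1 s).risk x := by
    intro s x
    rw [risk_rareObjective, risk_rareObjective]
    refine (hasSmoothGrad_inner _).le_of_stationary ?_ x
    rw [← hhm, hr]
    module
  have hmin : ∀ s : Bool, IsMinOn (rareObjective e h h' a q h0 h1 s).risk univ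
      ((boolSign s * r) • e) := by
    intro s x _
    have := hgrow s x
    have h2 : 0 ≤ hm / 2 * ‖x - (boolSign s * r) • e‖ ^ 2 := by positivity
    simp only [mem_ofPred_eq]
    linarith
  have hstr : ∀ s : Bool, StrongConvexOn univ lam (rareObjective e h h' a q h0 h1 s).risk := by
    intro s
    have h2 := (hasSmoothGrad_inner ((-(boolSign s * (q * a))) • e)).strongConvexOn (l := hm)
    have h3 : (rareObjective e h h' a q h0 h1 s).risk = fun w =>
      inner ℝ ((-(boolSign s * (q * a))) • e) w + hm / 2 * ‖w‖ ^ 2 := funext risk_rareObjective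
    rw [h3]
    exact h2.mono hlam
  have hval : ∀ s : Bool, (rareObjective e h h' a q h0 h1 s).risk 0
        - (rareObjective e h h' a q h0 h1 s).risk ((boolSign s * r) • e) = hm * r ^ 2 / 2 := by
    intro s
    rw [risk_rareObjective, risk_rareObjective, hr]
    simp only [inner_zero_right, norm_zero, real_inner_smul_left, real_inner_smul_right,
      real_inner_self_eq_norm_sq, he, norm_smul, Real.norm_eq_abs, mul_pow, sq_abs]
    have := boolSign_sq s
    rw [← hhm]
    linear_combination (hm * r ^ 2 - hm * r ^ 2 / 2) * this
  set S : Set (A.Seed × (Fin T → Fin b → Bool)) :=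
    univ ×ˢ (univ.pi fun _ => univ.pi fun _ => {false}) with hS
  have : IsProbabilityMeasure (rareMeasure q) := isProbabilityMeasure_rareMeasure h0 h1
  have hμS : ENNReal.ofReal (1 / 2) ≤ (A.seedDist.prod (Measure.pi fun _ : Fin T => Measure.pi
      fun _ : Fin b => rareMeasure q)) S := by
    rw [hS, Measure.prod_prod, measure_univ, one_mul, Measure.pi_pi]
    simp only [Measure.pi_pi, rareMeasure_false, Finset.prod_const, Finset.card_univ,
      Fintype.card_fin, ← pow_mul]
    rw [← ENNReal.ofReal_pow (by linarith)]
    apply ENNReal.ofReal_le_ofReal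
    have hB := one_add_mul_le_pow (a := -q) (by linarith) (b * T)
    have hn : (0 : ℝ) < b * T := by positivity
    have : (b * T : ℝ) * q ≤ 1 / 2 := by
      calc (b * T : ℝ) * q ≤ (b * T : ℝ) * (1 / (2 * (b * T))) := by gcongr
        _ = 1 / 2 := by field_simp
    push_cast at hB
    rw [← sub_eq_add_neg] at hB
    linarith
  obtain ⟨s, hs⟩ : ∃ s, ENNReal.ofReal (hm * r ^ 2 / 2) * (A.seedDist.prod (Measure.pi
      fun _ : Fin T => Measure.pi fun _ : Fin b => rareMeasure q)) S
      ≤ A.expectedError (rareObjective e h h' a q h0 h1 s) b := by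
    refine exists_mul_measure_le_lintegral (κ := Bool)
      (μ := A.seedDist.prod (Measure.pi fun _ : Fin T => Measure.pi fun _ : Fin b => rareMeasure q))
      (S := S) (e := ENNReal.ofReal (hm * r ^ 2 / 2))
      (f := fun s ω => ENNReal.ofReal ((rareObjective e h h' a q h0 h1 s).risk
        (A.result (rareObjective e h h' a q h0 h1 s) ω.1 ω.2)
        - (rareObjective e h h' a q h0 h1 s).optValue)) ?_ ?_
    · intro s
      have hg : Measurable (Function.uncurry (rareObjective e h h' a q h0 h1 s).lossGrad) := by
        refine measurable_from_prod_countable_left (β := Bool) fun z => ?_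
        have h2 := funext fun w => lossGrad_rareObjective (e := e) (a := a) (q := q) (h0 := h0)
          (h1 := h1) (s := s) hh hh' w z
        simp only [Function.uncurry]
        rw [h2]
        fun_prop
      have h3 : Measurable (rareObjective e h h' a q h0 h1 s).risk := by
        rw [funext risk_rareObjective]
        fun_prop
      exact ((h3.comp (FirstOrderAlgorithm.measurable_result hg)).sub_const _).ennreal_ofReal
    · intro ω hω
      have hz : ∀ t i, ω.2 t i = false := by
        intro t i
        have := hω.2
        simp only [mem_pi, mem_univ, forall_true_left, mem_singleton_iff] at this
        exact this t i
      have hres : ∀ s, A.result (rareObjective e h h' a q h0 h1 s) ω.1 ω.2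
          = A.point ω.1 (fun _ w => h' • w) T := by
        intro s
        refine FirstOrderAlgorithm.result_eq_point (G := fun w => h' • w) fun t w =>
          StochasticObjective.minibatchGrad_eq_of_forall hb fun i => ?_
        rw [hz, lossGrad_rareObjective hh hh']
        simp [rareSlope, rareCurv]
      simp only [Fintype.card_bool, Fintype.sum_bool, hres]
      set x := A.point ω.1 (fun _ w => h' • w) T
      rw [StochasticObjective.optValue_eq (hmin true), StochasticObjective.optValue_eq (hmin false)]
      have g1 := hgrow true x
      have g2 := hgrow false x
      rw [← ENNReal.ofReal_add (sub_nonneg.2 (hmin true (mem_univ x)))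
        (sub_nonneg.2 (hmin false (mem_univ x)))]
      have h2 : ((2 : ℕ) : ENNReal) = ENNReal.ofReal 2 := by simp
      rw [h2, ← ENNReal.ofReal_mul (by norm_num)]
      apply ENNReal.ofReal_le_ofReal
      have p := parallelogram_law_with_norm ℝ x (r • e)
      have n1 : ‖r • e‖ * ‖r • e‖ = r ^ 2 := by
        rw [norm_smul, he, mul_one, Real.norm_eq_abs, ← sq, sq_abs]
      have n2 : (boolSign true * r) • e = r • e := by simp [boolSign]
      have n3 : x - (boolSign false * r) • e = x + r • e := by simp [boolSign]
      rw [n2] at g1 ⊢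
      rw [n3] at g2
      have : hm * r ^ 2 ≤ hm / 2 * ‖x - r • e‖ ^ 2 + hm / 2 * ‖x + r • e‖ ^ 2 := by
        have : hm / 2 * ‖x - r • e‖ ^ 2 + hm / 2 * ‖x + r • e‖ ^ 2
          = hm * (‖x‖ ^ 2 + ‖r • e‖ ^ 2) := by linear_combination hm / 2 * p
        rw [this, sq ‖r • e‖, n1]
        nlinarith [mul_nonneg hpos.le (sq_nonneg ‖x‖)]
      linarith
  refine ⟨s, hstr s, hmin s, hval s, le_trans ?_ hs⟩
  have : hm * r ^ 2 / 4 = hm * r ^ 2 / 2 * (1 / 2) := by ring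
  rw [this, ENNReal.ofReal_mul (by positivity)]
  gcongr

end RareSample

/-- Lower bound by interpolation: as long as `b T ≤ H / (2 lam)`, the samples need not show anything
of the optimum. -/
theorem exists_interpolation_hard {d T b : ℕ} (hd : 0 < d) (hb : 0 < b) (hT : 0 < T)
    (A : FirstOrderAlgorithm.{u} d T) {H lam Δ : ℝ} (hH : 0 < H) (hΔ : 0 < Δ)
    (hlam : (b : ℝ) * T ≤ H / (2 * lam)) (hlam0 : 0 < lam) {σ : ℝ} :
    ∃ P : StochasticObjective d, P.InStronglyConvexClass H lam Δ σ ∧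
      ENNReal.ofReal (Δ / 2) ≤ A.expectedError P b := by
  have hn : (1 : ℝ) ≤ b * T := by exact_mod_cast Nat.mul_pos hb hT
  set q : ℝ := 1 / (2 * (b * T)) with hq
  have h0 : 0 < q := by positivity
  have h1 : q ≤ 1 := by rw [hq, div_le_one (by positivity)]; linarith
  have hqH : lam ≤ q * H := by
    rw [le_div_iff₀ (by positivity)] at hlam
    rw [hq, one_div, ← div_eq_inv_mul, le_div_iff₀ (by positivity)]
    linarith
  set r := √(2 * Δ / (q * H)) with hrd
  have hr2 : q * H * r ^ 2 = 2 * Δ := by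
    rw [hrd, Real.sq_sqrt (by positivity)]; field_simp
  have he : ‖(EuclideanSpace.single (⟨0, hd⟩ : Fin d) (1 : ℝ) : Euc d)‖ = 1 := by simp
  obtain ⟨s, hs1, hs2, hs3, hs4⟩ := exists_rareObjective (h := H) (h' := 0) (a := H * r) (q := q)
    (h0 := h0.le) (h1 := h1) hb hT A he hH.le le_rfl (lam := lam) (r := r)
    (by simpa using hqH) (by simpa using mul_pos h0 hH) le_rfl (by ring)
  simp only [mul_zero, add_zero, hr2] at hs3 hs4
  refine ⟨_, ⟨fun z => ((hasSmoothGrad_rareObjective hH.le le_rfl z).mono ?_).isConvexSmooth,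
    hs1, _, hs2, hs3.le.trans (by linarith), ?_⟩, le_trans (le_of_eq (by ring_nf)) hs4⟩
  · cases z <;> simp [rareCurv, hH.le]
  · have hz : ∀ z : Bool, ‖(rareObjective (EuclideanSpace.single (⟨0, hd⟩ : Fin d) (1 : ℝ))
        H 0 (H * r) q h0.le h1 s).lossGrad
        ((boolSign s * r) • EuclideanSpace.single (⟨0, hd⟩ : Fin d) (1 : ℝ)) z‖ ^ 2 = 0 := by
      intro z
      rw [lossGrad_rareObjective hH.le le_rfl, smul_smul, ← add_smul]
      have : -(boolSign s * rareSlope (H * r) z) + rareCurv H 0 z * (boolSign s * r) = 0 := by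
        cases z <;> simp [rareSlope, rareCurv]; ring
      rw [this]; simp
    have : IsProbabilityMeasure (rareMeasure q) := isProbabilityMeasure_rareMeasure h0.le h1
    refine ⟨Integrable.of_finite (α := Bool) (μ := rareMeasure q), ?_⟩
    refine (integral_congr_ae (Filter.Eventually.of_forall hz)).trans_le ?_
    exact (integral_zero Bool ℝ).trans_le (sq_nonneg σ)

/-- Lower bound by noise at the optimum. -/
theorem exists_noise_hard {d T b : ℕ} (hd : 0 < d) (hb : 0 < b) (hT : 0 < T)
    (A : FirstOrderAlgorithm.{u} d T) {H lam Δ σ : ℝ} (hΔ : 0 < Δ)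
    (hlam : lam ≤ H) (hlam0 : 0 < lam) :
    ∃ P : StochasticObjective d, P.InStronglyConvexClass H lam Δ σ ∧
      ENNReal.ofReal (min (σ ^ 2 / (lam * (b * T))) Δ / 8) ≤ A.expectedError P b := by
  have hn : (1 : ℝ) ≤ b * T := by exact_mod_cast Nat.mul_pos hb hT
  set q : ℝ := 1 / (2 * (b * T)) with hq
  have h0 : 0 < q := by positivity
  have h1 : q ≤ 1 := by rw [hq, div_le_one (by positivity)]; linarith
  set D := min (σ ^ 2 / (lam * (b * T))) Δ / 4 with hD
  have hD0 : 0 ≤ D := by positivity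
  set r := √(2 * D / lam) with hrd
  have hr2 : lam * r ^ 2 = 2 * D := by
    rw [hrd, Real.sq_sqrt (by positivity)]; field_simp
  have he : ‖(EuclideanSpace.single (⟨0, hd⟩ : Fin d) (1 : ℝ) : Euc d)‖ = 1 := by simp
  have hlq : q * lam + (1 - q) * lam = lam := by ring
  obtain ⟨s, hs1, hs2, hs3, hs4⟩ := exists_rareObjective (h := lam) (h' := lam) (a := lam * r / q)
    (q := q) (h0 := h0.le) (h1 := h1) hb hT A he hlam0.le hlam0.le (lam := lam) (r := r)
    hlq.ge (by rw [hlq]; exact hlam0) le_rfl (by rw [hlq]; field_simp)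
  rw [hlq, hr2] at hs3 hs4
  have hDΔ : D ≤ Δ := by
    have := min_le_right (σ ^ 2 / (lam * (b * T))) Δ
    rw [hD]; linarith
  refine ⟨_, ⟨fun z => ((hasSmoothGrad_rareObjective hlam0.le hlam0.le z).mono ?_).isConvexSmooth,
    hs1, _, hs2, hs3.le.trans (by linarith), ?_⟩,
    le_trans (le_of_eq (by rw [hD]; ring_nf)) hs4⟩
  · cases z <;> simpa [rareCurv] using hlam
  · have hz : ∀ z : Bool, ‖(rareObjective (EuclideanSpace.single (⟨0, hd⟩ : Fin d) (1 : ℝ))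
        lam lam (lam * r / q) q h0.le h1 s).lossGrad
        ((boolSign s * r) • EuclideanSpace.single (⟨0, hd⟩ : Fin d) (1 : ℝ)) z‖ ^ 2
          = (lam * r - rareSlope (lam * r / q) z) ^ 2 := by
      intro z
      rw [lossGrad_rareObjective hlam0.le hlam0.le, smul_smul, ← add_smul, norm_smul, he, mul_one,
        Real.norm_eq_abs, sq_abs]
      have : rareCurv lam lam z = lam := by simp [rareCurv]
      rw [this]
      linear_combination (lam * r - rareSlope (lam * r / q) z) ^ 2 * boolSign_sq s
    have : IsProbabilityMeasure (rareMeasure q) := isProbabilityMeasure_rareMeasure h0.le h1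
    refine ⟨Integrable.of_finite (α := Bool) (μ := rareMeasure q), ?_⟩
    refine (integral_congr_ae (Filter.Eventually.of_forall hz)).trans_le ?_
    refine (integral_rareMeasure h0.le h1 _).trans_le ?_
    have e1 : q * (lam * r - lam * r / q) ^ 2 + (1 - q) * (lam * r - 0) ^ 2
        = (1 - q) * ((lam * r) ^ 2 / q) := by
      field_simp; ring
    have e2 : (lam * r) ^ 2 / q ≤ σ ^ 2 := by
      have : (lam * r) ^ 2 / q = 4 * (lam * (b * T)) * D := by
        rw [mul_pow, sq lam, mul_assoc, hr2, hq]; field_simp; ring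
      rw [this]
      have hle : D ≤ σ ^ 2 / (lam * (b * T)) / 4 := by
        have := min_le_left (σ ^ 2 / (lam * (b * T))) Δ
        rw [hD]; linarith
      calc 4 * (lam * (b * T)) * D ≤ 4 * (lam * (b * T)) * (σ ^ 2 / (lam * (b * T)) / 4) := by
            gcongr
        _ = σ ^ 2 := by field_simp
    show q * (lam * r - lam * r / q) ^ 2 + (1 - q) * (lam * r - 0) ^ 2 ≤ σ ^ 2
    rw [e1]
    have : 0 ≤ (lam * r) ^ 2 / q := by positivity
    nlinarith

section Chain

variable {d : ℕ}

/-- The chain along the coordinates `p 0, p 1, …` with links `(p i, p (i + 1))` for `i < k`: a link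
is active when the difference of its two coordinates exceeds `c`. -/
noncomputable def chainFun (γ β c m : ℝ) (k : ℕ) (p : ℕ → Fin d) (w : Euc d) : ℝ :=
  -γ * w (p 0) + β * ∑ i ∈ Finset.range k, softRelu m (w (p i) - w (p (i + 1)) - c)

/-- The gradient of `chainFun`. -/
noncomputable def chainGrad (γ β c m : ℝ) (k : ℕ) (p : ℕ → Fin d) (w : Euc d) : Euc d :=
  (-γ) • EuclideanSpace.single (p 0) 1 +
    β • ∑ i ∈ Finset.range k, clip m (w (p i) - w (p (i + 1)) - c) •
      (EuclideanSpace.single (p i) 1 - EuclideanSpace.single (p (i + 1)) 1)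

theorem sum_sq_coord_le {ι : Type*} (S : Finset ι) {p : ι → Fin d} (hp : Set.InjOn p S)
    (w : Euc d) : ∑ i ∈ S, w (p i) ^ 2 ≤ ‖w‖ ^ 2 := by
  rw [EuclideanSpace.real_norm_sq_eq]
  rw [← Finset.sum_image (f := fun j => w j ^ 2) hp]
  exact Finset.sum_le_sum_of_subset_of_nonneg (Finset.subset_univ _) fun _ _ _ => sq_nonneg _

theorem abs_coord_le (w : Euc d) (j : Fin d) : |w j| ≤ ‖w‖ := by
  simpa using PiLp.norm_apply_le w j

theorem inner_chainGrad {γ β c m : ℝ} {k : ℕ} {p : ℕ → Fin d} (u v : Euc d) :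
    inner ℝ (chainGrad γ β c m k p u) v = -γ * v (p 0) + β * ∑ i ∈ Finset.range k,
      clip m (u (p i) - u (p (i + 1)) - c) * (v (p i) - v (p (i + 1))) := by
  simp only [chainGrad, inner_add_left, real_inner_smul_left, sum_inner, inner_sub_left,
    EuclideanSpace.inner_single_left, map_one, one_mul]

theorem hasSmoothGrad_chain {γ β c m : ℝ} (hβ : 0 ≤ β) (hm : 0 ≤ m) {k : ℕ} {p : ℕ → Fin d}
    (hp : Set.InjOn p (Finset.range (k + 1))) :
    HasSmoothGrad (4 * β) (chainFun γ β c m k p) (chainGrad γ β c m k p) := by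
  intro u w
  rw [inner_chainGrad]
  simp only [chainFun]
  set Δ := w - u with hΔ
  have hΔi : ∀ j, Δ j = w j - u j := fun j => rfl
  constructor
  · have : ∑ i ∈ Finset.range k, softRelu m (u (p i) - u (p (i + 1)) - c)
        + ∑ i ∈ Finset.range k, clip m (u (p i) - u (p (i + 1)) - c) * (Δ (p i) - Δ (p (i + 1)))
        ≤ ∑ i ∈ Finset.range k, softRelu m (w (p i) - w (p (i + 1)) - c) := by
      rw [← Finset.sum_add_distrib]
      refine Finset.sum_le_sum fun i _ => ?_
      have := softRelu_tangent_le (s := u (p i) - u (p (i + 1)) - c)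
        (s' := w (p i) - w (p (i + 1)) - c) hm
      refine le_trans (le_of_eq ?_) this
      rw [hΔi, hΔi]; ring
    have h2 := mul_le_mul_of_nonneg_left this hβ
    rw [hΔi]
    linarith
  · have h1 : ∑ i ∈ Finset.range k, softRelu m (w (p i) - w (p (i + 1)) - c)
        ≤ ∑ i ∈ Finset.range k, softRelu m (u (p i) - u (p (i + 1)) - c)
        + ∑ i ∈ Finset.range k, clip m (u (p i) - u (p (i + 1)) - c) * (Δ (p i) - Δ (p (i + 1)))
        + ∑ i ∈ Finset.range k, (Δ (p i) - Δ (p (i + 1))) ^ 2 / 2 := by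
      rw [← Finset.sum_add_distrib, ← Finset.sum_add_distrib]
      refine Finset.sum_le_sum fun i _ => ?_
      have := softRelu_le_tangent_add (s := u (p i) - u (p (i + 1)) - c)
        (s' := w (p i) - w (p (i + 1)) - c) hm
      refine le_trans this (le_of_eq ?_)
      rw [hΔi, hΔi]; ring
    have h3 : ∑ i ∈ Finset.range k, (Δ (p i) - Δ (p (i + 1))) ^ 2 / 2 ≤ 2 * ‖Δ‖ ^ 2 := by
      have hs := sum_sq_coord_le _ hp Δ
      have s1 := Finset.sum_range_succ (fun i => Δ (p i) ^ 2) k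
      have s2 := Finset.sum_range_succ' (fun i => Δ (p i) ^ 2) k
      have : ∑ i ∈ Finset.range k, (Δ (p i) - Δ (p (i + 1))) ^ 2 / 2
          ≤ ∑ i ∈ Finset.range k, Δ (p i) ^ 2 + ∑ i ∈ Finset.range k, Δ (p (i + 1)) ^ 2 := by
        rw [← Finset.sum_add_distrib]
        refine Finset.sum_le_sum fun i _ => ?_
        nlinarith [sq_nonneg (Δ (p i) + Δ (p (i + 1)))]
      nlinarith [sq_nonneg (Δ (p 0)), sq_nonneg (Δ (p k))]
    have h4 := mul_le_mul_of_nonneg_left (h1.trans (add_le_add_right h3 _)) hβ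
    rw [hΔi]
    linarith

theorem chainFun_lipschitz {γ β c m : ℝ} (hβ : 0 ≤ β) (hm : 0 ≤ m) {k n : ℕ} (hk : k ≤ n)
    {p : ℕ → Fin d} (u w : Euc d) :
    |chainFun γ β c m k p w - chainFun γ β c m k p u| ≤ (|γ| + 2 * β * m * n) * ‖w - u‖ := by
  have hΔi : ∀ j, |w j - u j| ≤ ‖w - u‖ := fun j => abs_coord_le (w - u) j
  have e : chainFun γ β c m k p w - chainFun γ β c m k p u = -γ * (w (p 0) - u (p 0))
      + β * ∑ i ∈ Finset.range k, (softRelu m (w (p i) - w (p (i + 1)) - c)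
        - softRelu m (u (p i) - u (p (i + 1)) - c)) := by
    rw [Finset.sum_sub_distrib]
    simp only [chainFun]
    ring
  have h1 : |∑ i ∈ Finset.range k, (softRelu m (w (p i) - w (p (i + 1)) - c)
        - softRelu m (u (p i) - u (p (i + 1)) - c))| ≤ n * (2 * m * ‖w - u‖) := by
    refine (Finset.abs_sum_le_sum_abs _ _).trans ?_
    refine (Finset.sum_le_card_nsmul _ _ (2 * m * ‖w - u‖) fun i _ => ?_).trans ?_
    · refine (softRelu_lipschitz hm).trans ?_
      have h2 : |w (p i) - w (p (i + 1)) - c - (u (p i) - u (p (i + 1)) - c)|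
          ≤ 2 * ‖w - u‖ := by
        have e2 : w (p i) - w (p (i + 1)) - c - (u (p i) - u (p (i + 1)) - c)
          = (w (p i) - u (p i)) - (w (p (i + 1)) - u (p (i + 1))) := by ring
        rw [e2]
        refine (abs_sub _ _).trans ?_
        linarith [hΔi (p i), hΔi (p (i + 1))]
      calc m * _ ≤ m * (2 * ‖w - u‖) := mul_le_mul_of_nonneg_left h2 hm
        _ = _ := by ring
    · rw [Finset.card_range, nsmul_eq_mul]
      have : (k : ℝ) ≤ n := by exact_mod_cast hk
      gcongr
  rw [e]
  refine (abs_add_le _ _).trans ?_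
  rw [abs_mul, abs_mul, abs_neg, abs_of_nonneg hβ]
  have h3 := mul_le_mul_of_nonneg_left (hΔi (p 0)) (abs_nonneg γ)
  have h4 := mul_le_mul_of_nonneg_left h1 hβ
  linarith

theorem chainFun_zero {γ β c m : ℝ} (hc : 0 ≤ c) {k : ℕ} {p : ℕ → Fin d} :
    chainFun γ β c m k p 0 = 0 := by
  simp [chainFun, softRelu_of_nonpos, hc]

theorem chainFun_eq_of_inactive {γ β c m : ℝ} {k n : ℕ} (hk : k ≤ n) {p : ℕ → Fin d} {w : Euc d}
    (h : ∀ i, k ≤ i → i ≤ n → |w (p i)| ≤ c / 2) :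
    chainFun γ β c m k p w = chainFun γ β c m n p w ∧
    chainGrad γ β c m k p w = chainGrad γ β c m n p w := by
  have hz : ∀ i ∈ Finset.range n, i ∉ Finset.range k → w (p i) - w (p (i + 1)) - c ≤ 0 := by
    intro i hi hi'
    rw [Finset.mem_range] at hi hi'
    have h1 := abs_le.1 (h i (by omega) (by omega))
    have h2 := abs_le.1 (h (i + 1) (by omega) (by omega))
    linarith [h1.2, h2.1]
  have hsub : Finset.range k ⊆ Finset.range n := Finset.range_mono hk
  constructor
  · unfold chainFun
    rw [Finset.sum_subset hsub fun i hi hi' => softRelu_of_nonpos (hz i hi hi')]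
  · unfold chainGrad
    rw [Finset.sum_subset hsub fun i hi hi' => by rw [clip_of_nonpos (hz i hi hi'), zero_smul]]

theorem chainFun_congr {γ β c m : ℝ} {k : ℕ} {p p' : ℕ → Fin d} (h : ∀ i ≤ k, p i = p' i) :
    chainFun γ β c m k p = chainFun γ β c m k p' ∧
    chainGrad γ β c m k p = chainGrad γ β c m k p' := by
  constructor
  · funext w
    unfold chainFun
    rw [h 0 (Nat.zero_le _)]
    congr 2
    refine Finset.sum_congr rfl fun i hi => ?_
    rw [Finset.mem_range] at hi
    rw [h i (by omega), h (i + 1) (by omega)]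
  · funext w
    unfold chainGrad
    rw [h 0 (Nat.zero_le _)]
    congr 2
    refine Finset.sum_congr rfl fun i hi => ?_
    rw [Finset.mem_range] at hi
    rw [h i (by omega), h (i + 1) (by omega)]

/-- The minimizer of the regularized chain. -/
noncomputable def chainMin (A g : ℝ) (n : ℕ) (p : ℕ → Fin d) : Euc d :=
  ∑ i ∈ Finset.range (n + 1), (A * g⁻¹ ^ i) • EuclideanSpace.single (p i) 1

theorem chainMin_apply {A g : ℝ} {n : ℕ} {p : ℕ → Fin d} (hp : Set.InjOn p (Finset.range (n + 1)))
    {i : ℕ} (hi : i ≤ n) : chainMin A g n p (p i) = A * g⁻¹ ^ i := by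
  unfold chainMin
  rw [WithLp.ofLp_sum, Finset.sum_apply, Finset.sum_eq_single i]
  · simp
  · intro j hj hji
    have : p i ≠ p j := fun h => hji (hp hj (by simp; omega) h.symm)
    simp [this]
  · intro h; exact absurd (Finset.mem_range.2 (by omega)) h

theorem sum_smul_sub_telescope {V : Type*} [AddCommGroup V] [Module ℝ V] (a : ℕ → ℝ)
    (v : ℕ → V) (n : ℕ) :
    ∑ i ∈ Finset.range n, a i • (v i - v (i + 1)) =
      a 0 • v 0 - ∑ i ∈ Finset.range n, (a i - a (i + 1)) • v (i + 1) - a n • v n := by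
  induction n with
  | zero => simp
  | succ n ih =>
    rw [Finset.sum_range_succ, Finset.sum_range_succ, ih]
    module

variable {A g β lam c γ m : ℝ} {n : ℕ} {p : ℕ → Fin d}

theorem chainMin_link (hA : 0 ≤ A) (hg : 1 < g) (hc : c = A * g⁻¹ ^ n * (1 - g⁻¹))
    (hm : A ≤ m) (hp : Set.InjOn p (Finset.range (n + 1))) {i : ℕ} (hi : i < n) :
    0 ≤ chainMin A g n p (p i) - chainMin A g n p (p (i + 1)) - c ∧
    clip m (chainMin A g n p (p i) - chainMin A g n p (p (i + 1)) - c)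
      = A * (1 - g⁻¹) * (g⁻¹ ^ i - g⁻¹ ^ n) := by
  have hg0 : 0 < g := by linarith
  have hi0 : 0 < g⁻¹ := inv_pos.2 hg0
  have hi1 : g⁻¹ ≤ 1 := inv_le_one_of_one_le₀ hg.le
  rw [chainMin_apply hp hi.le, chainMin_apply hp hi, hc]
  have e : A * g⁻¹ ^ i - A * g⁻¹ ^ (i + 1) - A * g⁻¹ ^ n * (1 - g⁻¹)
    = A * (1 - g⁻¹) * (g⁻¹ ^ i - g⁻¹ ^ n) := by ring
  rw [e]
  have h1 : g⁻¹ ^ n ≤ g⁻¹ ^ i := pow_le_pow_of_le_one hi0.le hi1 hi.le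
  have h2 : g⁻¹ ^ i ≤ 1 := pow_le_one₀ hi0.le hi1
  have h3 : 0 < g⁻¹ ^ n := by positivity
  have h4 : 0 ≤ A * (1 - g⁻¹) * (g⁻¹ ^ i - g⁻¹ ^ n) :=
    mul_nonneg (mul_nonneg hA (by linarith)) (by linarith)
  refine ⟨h4, clip_of_mem h4 (le_trans ?_ hm)⟩
  calc A * (1 - g⁻¹) * (g⁻¹ ^ i - g⁻¹ ^ n) ≤ A * 1 * 1 := by
        gcongr <;> linarith
    _ = A := by ring

theorem chainGrad_chainMin (hA : 0 ≤ A) (hg : 1 < g) (hc : c = A * g⁻¹ ^ n * (1 - g⁻¹))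
    (hβ : β * (g - 1) ^ 2 = lam * g) (hγ : γ = β * (A * (g - 1) - c)) (hm : A ≤ m)
    (hp : Set.InjOn p (Finset.range (n + 1))) :
    chainGrad γ β c m n p (chainMin A g n p) + lam • chainMin A g n p = 0 := by
  have hg0 : g ≠ 0 := by linarith
  have e1 : ∑ i ∈ Finset.range n, clip m (chainMin A g n p (p i) - chainMin A g n p (p (i + 1)) - c) •
      ((EuclideanSpace.single (p i) 1 : Euc d) - EuclideanSpace.single (p (i + 1)) 1)
      = ∑ i ∈ Finset.range n, (A * (1 - g⁻¹) * (g⁻¹ ^ i - g⁻¹ ^ n)) •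
      ((EuclideanSpace.single (p i) 1 : Euc d) - EuclideanSpace.single (p (i + 1)) 1) :=
    Finset.sum_congr rfl fun i hi => by
      rw [(chainMin_link hA hg hc hm hp (Finset.mem_range.1 hi)).2]
  unfold chainGrad
  rw [e1, sum_smul_sub_telescope (fun i => A * (1 - g⁻¹) * (g⁻¹ ^ i - g⁻¹ ^ n))
    (fun i => (EuclideanSpace.single (p i) 1 : Euc d)) n]
  unfold chainMin
  rw [Finset.sum_range_succ']
  have e2 : ∀ i, A * (1 - g⁻¹) * (g⁻¹ ^ i - g⁻¹ ^ n) - A * (1 - g⁻¹) * (g⁻¹ ^ (i + 1) - g⁻¹ ^ n)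
      = ((g - 1) ^ 2 / g) * (A * g⁻¹ ^ (i + 1)) := by
    intro i
    have h := mul_inv_cancel₀ hg0
    rw [div_eq_mul_inv]
    linear_combination -(A * g⁻¹ ^ i * (1 - 2 * g⁻¹ + g * g⁻¹)) * h
  simp only [e2, mul_smul ((g - 1) ^ 2 / g), ← Finset.smul_sum, sub_self, mul_zero, zero_smul,
    sub_zero, pow_zero, mul_one]
  set X : Euc d := ∑ i ∈ Finset.range n, (A * g⁻¹ ^ (i + 1)) • EuclideanSpace.single (p (i + 1)) 1
  have e3 : lam = β * ((g - 1) ^ 2 / g) := by rw [← mul_div_assoc, hβ]; field_simp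
  have e4 : -γ + β * (A * (1 - g⁻¹) * (1 - g⁻¹ ^ n)) + lam * A = 0 := by
    rw [hγ, hc, e3]; field_simp; ring
  have : (-γ) • (EuclideanSpace.single (p 0) 1 : Euc d)
      + β • ((A * (1 - g⁻¹) * (1 - g⁻¹ ^ n)) • EuclideanSpace.single (p 0) 1
        - ((g - 1) ^ 2 / g) • X) + lam • (X + A • EuclideanSpace.single (p 0) 1)
      = (-γ + β * (A * (1 - g⁻¹) * (1 - g⁻¹ ^ n)) + lam * A) • EuclideanSpace.single (p 0) 1
        + (lam - β * ((g - 1) ^ 2 / g)) • X := by module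
  rw [this, e4, e3]
  simp

/-- The decrease of the regularized chain from the origin to its minimizer. -/
theorem neg_chainFun_chainMin_le (hA : 0 ≤ A) (hg : 1 < g) (hc : c = A * g⁻¹ ^ n * (1 - g⁻¹))
    (hβ0 : 0 ≤ β) (hlam : 0 ≤ lam) (hγ : γ = β * (A * (g - 1) - c)) (hm : A ≤ m)
    (hp : Set.InjOn p (Finset.range (n + 1))) :
    -(chainFun γ β c m n p (chainMin A g n p) + lam / 2 * ‖chainMin A g n p‖ ^ 2)
      ≤ β * (g - 1) * A ^ 2 := by
  have hi1 : g⁻¹ ≤ 1 := inv_le_one_of_one_le₀ hg.le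
  have hi0 : 0 < g⁻¹ := inv_pos.2 (by linarith)
  have hc0 : 0 ≤ c := by
    rw [hc]; exact mul_nonneg (by positivity) (by linarith)
  have h0 : chainMin A g n p (p 0) = A := by
    rw [chainMin_apply hp (Nat.zero_le _)]; simp
  have h1 : 0 ≤ ∑ i ∈ Finset.range n,
      softRelu m (chainMin A g n p (p i) - chainMin A g n p (p (i + 1)) - c) :=
    Finset.sum_nonneg fun i _ => by
      have := softRelu_tangent_le (s := 0)
        (s' := chainMin A g n p (p i) - chainMin A g n p (p (i + 1)) - c) (hA.trans hm)
      rw [softRelu_of_nonpos le_rfl, clip_of_nonpos le_rfl] at this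
      simpa using this
  have h2 := mul_nonneg hβ0 h1
  have h3 : 0 ≤ lam / 2 * ‖chainMin A g n p‖ ^ 2 := by positivity
  unfold chainFun
  rw [h0, hγ]
  have h4 : 0 ≤ β * A * c := by positivity
  nlinarith

end Chain

/-- The parameters of a regularized chain that is hidden behind a wall far from the origin. -/
structure ChainParams where
  /-- weight of the linear term -/
  γ : ℝ
  /-- strength of the links -/
  β : ℝ
  /-- length at which the links become active -/
  c : ℝ
  /-- bound on the slope of the links -/
  m : ℝ
  /-- width of the glueing region -/
  τ : ℝ
  /-- radius at which the wall is rounded -/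
  R : ℝ
  /-- depth of the wall -/
  K : ℝ
  /-- weight of the quadratic term -/
  lam : ℝ
  /-- number of links -/
  n : ℕ

namespace ChainParams

variable {d : ℕ} (q : ChainParams)

/-- A bound on the slope of the chain. -/
noncomputable def slope : ℝ := |q.γ| + 2 * q.β * q.m * q.n

/-- The wall. -/
noncomputable def wall (w : Euc d) : ℝ := (q.slope + 1) * √(q.R ^ 2 + ‖w‖ ^ 2) - q.K

/-- The gradient of the wall. -/
noncomputable def wallGrad (w : Euc d) : Euc d := ((q.slope + 1) / √(q.R ^ 2 + ‖w‖ ^ 2)) • w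

/-- The chain with `k` links. -/
noncomputable def chain (k : ℕ) (p : ℕ → Fin d) : Euc d → ℝ := chainFun q.γ q.β q.c q.m k p

/-- The chain with `k` links, hidden behind the wall. -/
noncomputable def base (k : ℕ) (p : ℕ → Fin d) : Euc d → ℝ := glue q.τ (q.chain k p) q.wall

/-- The gradient of `base`. -/
noncomputable def baseGrad (k : ℕ) (p : ℕ → Fin d) : Euc d → Euc d :=
  glueGrad q.τ (q.chain k p) q.wall (chainGrad q.γ q.β q.c q.m k p) q.wallGrad

/-- The gradient of the regularized hidden chain with `k` links. -/
noncomputable def grad (k : ℕ) (p : ℕ → Fin d) (w : Euc d) : Euc d :=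
  q.baseGrad k p w + q.lam • w

/-- The sign conditions on the parameters. -/
structure Valid : Prop where
  β_nonneg : 0 ≤ q.β
  m_nonneg : 0 ≤ q.m
  c_nonneg : 0 ≤ q.c
  lam_nonneg : 0 ≤ q.lam
  τ_pos : 0 < q.τ
  R_pos : 0 < q.R
  slope_le : (q.slope + 1) / q.R ≤ 4 * q.β

variable {q}

theorem Valid.slope_nonneg (hq : q.Valid) : 0 ≤ q.slope := by
  have := hq.β_nonneg
  have := hq.m_nonneg
  unfold slope
  positivity

theorem Valid.abs_chain_le (hq : q.Valid) {k : ℕ} (hk : k ≤ q.n) (p : ℕ → Fin d) (w : Euc d) :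
    |q.chain k p w| ≤ q.slope * ‖w‖ := by
  have := chainFun_lipschitz (γ := q.γ) (c := q.c) hq.β_nonneg hq.m_nonneg hk (p := p) 0 w
  rw [chainFun_zero hq.c_nonneg, sub_zero, sub_zero] at this
  exact this

theorem Valid.hasSmoothGrad_base (hq : q.Valid) {p : ℕ → Fin d}
    (hp : Set.InjOn p (Finset.range (q.n + 1))) :
    HasSmoothGrad (4 * q.β + (2 * (q.slope + 1)) ^ 2 / q.τ) (q.base q.n p) (q.baseGrad q.n p) := by
  have hs := hq.slope_nonneg
  refine hasSmoothGrad_glue hq.τ_pos (hasSmoothGrad_chain hq.β_nonneg hq.m_nonneg hp)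
    (hasSmoothGrad_sqrt (by linarith) hq.R_pos) hq.slope_le fun u w => ?_
  have h1 : |q.chain q.n p w - q.chain q.n p u| ≤ q.slope * ‖w - u‖ :=
    chainFun_lipschitz hq.β_nonneg hq.m_nonneg le_rfl u w
  have h2 : |q.wall w - q.wall u| ≤ (q.slope + 1) * ‖w - u‖ := by
    have e : q.wall w - q.wall u
      = (q.slope + 1) * (√(q.R ^ 2 + ‖w‖ ^ 2) - √(q.R ^ 2 + ‖u‖ ^ 2)) := by
      unfold wall; ring
    rw [e, abs_mul, abs_of_nonneg (by linarith)]
    exact mul_le_mul_of_nonneg_left (sqrt_add_norm_sq_lipschitz q.R w u) (by linarith)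
  have e : (q.chain q.n p w - q.wall w) - (q.chain q.n p u - q.wall u)
    = (q.chain q.n p w - q.chain q.n p u) - (q.wall w - q.wall u) := by ring
  rw [e]
  refine (abs_sub _ _).trans ?_
  nlinarith [norm_nonneg (w - u)]

/-- Far away, or where the later coordinates are small, the gradient shows only the first `k`
links. -/
theorem Valid.grad_eq (hq : q.Valid) {k : ℕ} (hk : k ≤ q.n) {p : ℕ → Fin d} {w : Euc d}
    (h : q.K ≤ ‖w‖ ∨ ∀ i, k ≤ i → i ≤ q.n → |w (p i)| ≤ q.c / 2) :
    q.grad k p w = q.grad q.n p w := by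
  have hs := hq.slope_nonneg
  unfold grad baseGrad glueGrad
  rcases h with h | h
  · have key : ∀ j ≤ q.n, q.chain j p w - q.wall w ≤ 0 := by
      intro j hj
      have h1 := (abs_le.1 (hq.abs_chain_le hj p w)).2
      have h2 : ‖w‖ ≤ √(q.R ^ 2 + ‖w‖ ^ 2) :=
        Real.le_sqrt_of_sq_le (by nlinarith [sq_nonneg q.R])
      have h3 := mul_le_mul_of_nonneg_left h2 (by linarith : 0 ≤ q.slope + 1)
      unfold wall
      linarith
    rw [clip_of_nonpos (key k hk), clip_of_nonpos (key q.n le_rfl)]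
    simp
  · obtain ⟨h1, h2⟩ := chainFun_eq_of_inactive (γ := q.γ) (β := q.β) (m := q.m) hk h
    unfold chain
    rw [h1, h2]

theorem Valid.le_chain_sub_wall (hq : q.Valid) (p : ℕ → Fin d) {w : Euc d}
    (h : q.τ + (q.slope + 1) * (q.R + 2 * ‖w‖) ≤ q.K) :
    q.τ ≤ q.chain q.n p w - q.wall w := by
  have hs := hq.slope_nonneg
  have h1 := (abs_le.1 (hq.abs_chain_le le_rfl p w)).1
  have h2 : √(q.R ^ 2 + ‖w‖ ^ 2) ≤ q.R + ‖w‖ := by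
    apply Real.sqrt_le_iff.2
    have := hq.R_pos
    constructor
    · positivity
    · nlinarith [norm_nonneg w]
  have h3 := mul_le_mul_of_nonneg_left h2 (by linarith : 0 ≤ q.slope + 1)
  unfold wall
  nlinarith [norm_nonneg w]

theorem Valid.base_eq (hq : q.Valid) (p : ℕ → Fin d) {w : Euc d}
    (h : q.τ ≤ q.chain q.n p w - q.wall w) :
    q.base q.n p w = q.chain q.n p w - q.τ / 2 ∧
    q.baseGrad q.n p w = chainGrad q.γ q.β q.c q.m q.n p w := by
  have hτ := hq.τ_pos
  constructor
  · unfold base glue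
    rw [softRelu_of_ge hτ.le h]
    field_simp
    ring
  · unfold baseGrad glueGrad
    rw [clip_of_ge hτ.le h, div_self hτ.ne']
    simp

theorem measurable_base (k : ℕ) (p : ℕ → Fin d) : Measurable (q.base k p) := by
  unfold base glue chain chainFun wall softRelu clip
  fun_prop

theorem measurable_grad (k : ℕ) (p : ℕ → Fin d) : Measurable (q.grad k p) := by
  unfold grad baseGrad glueGrad chain chainFun chainGrad wall wallGrad softRelu clip
  fun_prop

/-- The regularized hidden chain as a stochastic objective without noise. -/
noncomputable def objective (q : ChainParams) (p : ℕ → Fin d) : StochasticObjective d where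
  Sample := Unit
  dist := Measure.dirac ()
  loss w _ := q.base q.n p w + q.lam / 2 * ‖w‖ ^ 2
  measurable_loss := by
    have := measurable_base (q := q) q.n p
    simp only [Function.uncurry_def]
    fun_prop
  integrable_loss w := integrable_const _

theorem risk_objective (p : ℕ → Fin d) :
    (q.objective p).risk = fun w => q.base q.n p w + q.lam / 2 * ‖w‖ ^ 2 := by
  funext w
  exact integral_dirac (α := Unit) _ _

theorem Valid.hasSmoothGrad_objective (hq : q.Valid) {p : ℕ → Fin d}
    (hp : Set.InjOn p (Finset.range (q.n + 1))) (z : Unit) :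
    HasSmoothGrad (4 * q.β + (2 * (q.slope + 1)) ^ 2 / q.τ + q.lam)
      (fun w => (q.objective p).loss w z) (q.grad q.n p) :=
  (hq.hasSmoothGrad_base hp).add (hasSmoothGrad_half_norm_sq hq.lam_nonneg)

theorem Valid.lossGrad_objective (hq : q.Valid) {p : ℕ → Fin d}
    (hp : Set.InjOn p (Finset.range (q.n + 1))) (w : Euc d) (z : Unit) :
    (q.objective p).lossGrad w z = q.grad q.n p w :=
  (hq.hasSmoothGrad_objective hp z).gradient_eq w

end ChainParams

section Placement

/-- The coordinate of node `i` of the chain, when it is the one with number `J i` in block `i`. -/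
def place {n N : ℕ} (J : Fin (n + 1) → Fin N) (i : ℕ) : Fin ((n + 1) * N) :=
  finProdFinEquiv (Fin.ofNat (n + 1) i, J (Fin.ofNat (n + 1) i))

theorem place_injOn {n N : ℕ} (J : Fin (n + 1) → Fin N) :
    Set.InjOn (place J) (Finset.range (n + 1)) := by
  intro i hi j hj h
  have h1 := congrArg (fun x => x.1.val) (finProdFinEquiv.injective h)
  simp only [Fin.ofNat] at h1
  simp only [Finset.coe_range, mem_Iio] at hi hj
  rwa [Nat.mod_eq_of_lt hi, Nat.mod_eq_of_lt hj] at h1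

theorem place_val {n N : ℕ} (J : Fin (n + 1) → Fin N) (i : Fin (n + 1)) :
    place J i = finProdFinEquiv (i, J i) := by
  have : Fin.ofNat (n + 1) i = i := by ext; simp [Fin.ofNat, Nat.mod_eq_of_lt i.2]
  rw [place, this]

theorem place_update {n N : ℕ} (J : Fin (n + 1) → Fin N) (i : Fin (n + 1)) (j : Fin N) {k : ℕ}
    (hk : k < i) : place (Function.update J i j) k = place J k := by
  have : Fin.ofNat (n + 1) k ≠ i := by
    intro h
    have := congrArg Fin.val h
    simp only [Fin.ofNat] at this
    rw [Nat.mod_eq_of_lt (hk.trans i.2)] at this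
    omega
  rw [place, place, Function.update_of_ne this]

/-- A choice `J i` that is independent of a set of at most `Q` values rarely falls into it. -/
theorem card_filter_mem_mul_le {ι : Type*} [Fintype ι] [DecidableEq ι] {N Q : ℕ} (i : ι)
    (F : (ι → Fin N) → Finset (Fin N)) (hF : ∀ J j, F (Function.update J i j) = F J)
    (hQ : ∀ J, (F J).card ≤ Q) :
    (Finset.univ.filter fun J : ι → Fin N => J i ∈ F J).card * N ≤ Fintype.card (ι → Fin N) * Q := by
  have h1 : (Finset.univ.sigma F).card ≤ Fintype.card (ι → Fin N) * Q := by
    rw [Finset.card_sigma]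
    exact (Finset.sum_le_card_nsmul _ _ Q fun J _ => hQ J).trans (by simp)
  refine le_trans ?_ h1
  have h2 : ((Finset.univ.filter fun J : ι → Fin N => J i ∈ F J) ×ˢ
      (Finset.univ : Finset (Fin N))).card ≤ (Finset.univ.sigma F).card := by
    refine Finset.card_le_card_of_injOn (fun x => ⟨Function.update x.1 i x.2, x.1 i⟩) ?_ ?_
    · rintro ⟨J, j⟩ hx
      simp only [Finset.coe_product, Finset.coe_filter, Finset.mem_univ, true_and, Finset.coe_univ,
        mem_prod, mem_ofPred_eq, mem_univ, and_true] at hx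
      simpa [hF] using hx
    · rintro ⟨J, j⟩ _ ⟨J', j'⟩ _ h
      simp only [Sigma.mk.injEq, heq_eq_eq] at h
      have e1 : j = j' := by simpa using congrFun h.1 i
      have e2 : J = J' := by
        have := congrArg (fun f => Function.update f i (J i)) h.1
        simp only [Function.update_idem, Function.update_eq_self] at this
        rw [this, h.2, Function.update_eq_self]
      rw [e1, e2]
  rwa [Finset.card_product, Finset.card_univ, Fintype.card_fin] at h2

end Placement

namespace ChainParams

variable {q : ChainParams} {N T b : ℕ}

/-- The points that are chosen on the basis of the first links only. -/
noncomputable def hiddenPoint (q : ChainParams) (A : FirstOrderAlgorithm.{u} ((q.n + 1) * N) T)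
    (s : A.Seed) (J : Fin (q.n + 1) → Fin N) (k : ℕ) : Euc ((q.n + 1) * N) :=
  A.point s (fun k => q.grad k (place J)) k

theorem hiddenPoint_update {A : FirstOrderAlgorithm.{u} ((q.n + 1) * N) T} {s : A.Seed}
    {J : Fin (q.n + 1) → Fin N} {k : ℕ} (hk : k ≤ T) {i : Fin (q.n + 1)} (hi : k ≤ i) (j : Fin N) :
    q.hiddenPoint A s (Function.update J i j) k = q.hiddenPoint A s J k := by
  refine FirstOrderAlgorithm.point_congr hk fun l hl => ?_
  obtain ⟨h1, h2⟩ := chainFun_congr (γ := q.γ) (β := q.β) (c := q.c) (m := q.m) (k := l)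
    (p := place (Function.update J i j)) (p' := place J)
    fun i' hi' => place_update J i j (by omega)
  unfold grad baseGrad chain
  rw [h1, h2]

open Classical in
/-- The values of `J i` that the point `k` makes visible. -/
noncomputable def visible (q : ChainParams) (A : FirstOrderAlgorithm.{u} ((q.n + 1) * N) T)
    (s : A.Seed) (k : ℕ) (i : Fin (q.n + 1)) (J : Fin (q.n + 1) → Fin N) : Finset (Fin N) :=
  Finset.univ.filter fun j => ‖q.hiddenPoint A s J k‖ < q.K ∧
    q.c / 2 < |q.hiddenPoint A s J k (finProdFinEquiv (i, j))|

theorem card_visible_le {A : FirstOrderAlgorithm.{u} ((q.n + 1) * N) T} {s : A.Seed}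
    {k Q : ℕ} {i : Fin (q.n + 1)} {J : Fin (q.n + 1) → Fin N} (hc : 0 < q.c)
    (hQ : q.K ^ 2 / (q.c / 2) ^ 2 ≤ Q) : (q.visible A s k i J).card ≤ Q := by
  set w := q.hiddenPoint A s J k with hw
  rcases lt_or_ge ‖w‖ q.K with h | h
  · have h1 := sum_sq_coord_le (q.visible A s k i J) (p := fun j => finProdFinEquiv (i, j))
      (fun a _ b _ hab => by simpa using hab) w
    have h2 : (q.visible A s k i J).card • (q.c / 2) ^ 2
        ≤ ∑ j ∈ q.visible A s k i J, w (finProdFinEquiv (i, j)) ^ 2 := by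
      refine Finset.card_nsmul_le_sum _ _ _ fun j hj => ?_
      simp only [visible, Finset.mem_filter, Finset.mem_univ, true_and] at hj
      rw [← sq_abs (w _)]
      exact pow_le_pow_left₀ (by linarith) hj.2.le 2
    have h3 : ‖w‖ ^ 2 ≤ q.K ^ 2 := pow_le_pow_left₀ (norm_nonneg _) h.le 2
    rw [nsmul_eq_mul] at h2
    have h4 : ((q.visible A s k i J).card : ℝ) ≤ q.K ^ 2 / (q.c / 2) ^ 2 := by
      rw [le_div_iff₀ (by positivity)]; linarith
    exact_mod_cast h4.trans hQ
  · have : q.visible A s k i J = ∅ := by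
      simp only [visible, Finset.filter_eq_empty_iff, ← hw]
      intro j _ hj
      linarith [hj.1]
    simp [this]

open Classical in
/-- The placements of which each node stays hidden until the round in which it is reached. -/
noncomputable def wellHidden (q : ChainParams) (A : FirstOrderAlgorithm.{u} ((q.n + 1) * N) T)
    (s : A.Seed) : Finset (Fin (q.n + 1) → Fin N) :=
  Finset.univ.filter fun J => ∀ k ≤ T, ∀ i : Fin (q.n + 1), k ≤ i → J i ∉ q.visible A s k i J

theorem card_le_two_mul_wellHidden {A : FirstOrderAlgorithm.{u} ((q.n + 1) * N) T} {s : A.Seed}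
    {Q : ℕ} (hc : 0 < q.c) (hQ : q.K ^ 2 / (q.c / 2) ^ 2 ≤ Q) (hQ0 : 0 < Q)
    (hN : N = 2 * ((T + 1) * (q.n + 1) * Q)) :
    Fintype.card (Fin (q.n + 1) → Fin N) ≤ 2 * (q.wellHidden A s).card := by
  classical
  set C := Fintype.card (Fin (q.n + 1) → Fin N)
  have h1 : (q.wellHidden A s).card + (q.wellHidden A s)ᶜ.card = C :=
    Finset.card_add_card_compl _
  set I := (Finset.range (T + 1) ×ˢ (Finset.univ : Finset (Fin (q.n + 1)))).filter
    fun x => x.1 ≤ x.2.val with hI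
  have hsub : (q.wellHidden A s)ᶜ ⊆ I.biUnion fun x =>
      Finset.univ.filter fun J => J x.2 ∈ q.visible A s x.1 x.2 J := by
    intro J hJ
    simp only [wellHidden, Finset.mem_compl, Finset.mem_filter, Finset.mem_univ, true_and] at hJ
    push Not at hJ
    obtain ⟨k, hk, i, hi, hJ⟩ := hJ
    simp only [Finset.mem_biUnion, Finset.mem_filter, Finset.mem_univ, true_and]
    refine ⟨(k, i), ?_, hJ⟩
    simp [hI, hi]
    omega
  have h2 : (q.wellHidden A s)ᶜ.card * N ≤ (T + 1) * (q.n + 1) * (C * Q) := by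
    calc (q.wellHidden A s)ᶜ.card * N
        ≤ (∑ x ∈ I, (Finset.univ.filter fun J => J x.2 ∈ q.visible A s x.1 x.2 J).card) * N :=
          Nat.mul_le_mul_right _ ((Finset.card_le_card hsub).trans Finset.card_biUnion_le)
      _ = ∑ x ∈ I, (Finset.univ.filter fun J => J x.2 ∈ q.visible A s x.1 x.2 J).card * N :=
          Finset.sum_mul _ _ _
      _ ≤ I.card • (C * Q) := by
          refine Finset.sum_le_card_nsmul _ _ _ fun x hx => ?_
          simp only [hI, Finset.mem_filter, Finset.mem_product, Finset.mem_range] at hx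
          refine card_filter_mem_mul_le x.2 _ (fun J j => ?_) fun J => card_visible_le hc hQ
          unfold visible
          rw [hiddenPoint_update (by omega) hx.2]
      _ ≤ (T + 1) * (q.n + 1) * (C * Q) := by
          rw [smul_eq_mul]
          refine Nat.mul_le_mul_right _ ((Finset.card_filter_le _ _).trans ?_)
          simp
  have h3 : 0 < (T + 1) * (q.n + 1) * Q := by positivity
  have h4 : 2 * (q.wellHidden A s)ᶜ.card ≤ C := by
    refine Nat.le_of_mul_le_mul_right (c := (T + 1) * (q.n + 1) * Q) ?_ h3
    calc 2 * (q.wellHidden A s)ᶜ.card * ((T + 1) * (q.n + 1) * Q)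
        = (q.wellHidden A s)ᶜ.card * N := by
          generalize (q.wellHidden A s)ᶜ.card = x
          rw [hN]; ring
      _ ≤ _ := h2
      _ = C * ((T + 1) * (q.n + 1) * Q) := by ring
  omega

/-- At the points of a well hidden chain, the coordinates to come are small, or the point is far
away. -/
theorem small_of_wellHidden {A : FirstOrderAlgorithm.{u} ((q.n + 1) * N) T} {s : A.Seed}
    {J : Fin (q.n + 1) → Fin N} (hJ : J ∈ q.wellHidden A s) {k : ℕ} (hk : k ≤ T) :
    q.K ≤ ‖q.hiddenPoint A s J k‖ ∨ ∀ i, k ≤ i → i ≤ q.n →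
      |q.hiddenPoint A s J k (place J i)| ≤ q.c / 2 := by
  classical
  rcases le_or_gt q.K ‖q.hiddenPoint A s J k‖ with h | h
  · exact Or.inl h
  · refine Or.inr fun i hi hin => ?_
    simp only [wellHidden, Finset.mem_filter, Finset.mem_univ, true_and] at hJ
    have h1 := hJ k hk ⟨i, by omega⟩ hi
    simp only [visible, Finset.mem_filter, Finset.mem_univ, true_and, h] at h1
    rw [← place_val] at h1
    exact not_lt.1 h1

theorem Valid.result_eq_hiddenPoint (hq : q.Valid) (hb : 0 < b) (hT : T ≤ q.n)
    {A : FirstOrderAlgorithm.{u} ((q.n + 1) * N) T} {s : A.Seed} {J : Fin (q.n + 1) → Fin N}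
    (hJ : J ∈ q.wellHidden A s) (z : Fin T → Fin b → Unit) :
    A.result (q.objective (place J)) s z = q.hiddenPoint A s J T := by
  have h1 : A.result (q.objective (place J)) s z
      = A.point s (fun _ => q.grad q.n (place J)) T :=
    FirstOrderAlgorithm.result_eq_point fun t w =>
      StochasticObjective.minibatchGrad_eq_of_forall hb fun i =>
        hq.lossGrad_objective (place_injOn J) w _
  rw [h1]
  symm
  refine FirstOrderAlgorithm.point_congr le_rfl fun k hk => ?_
  exact hq.grad_eq (by omega) (small_of_wellHidden hJ hk.le)

end ChainParams

theorem norm_chainMin_le {d n : ℕ} {a g : ℝ} (ha : 0 ≤ a) (hg : 1 < g) (p : ℕ → Fin d) :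
    ‖chainMin a g n p‖ ≤ (n + 1) * a := by
  unfold chainMin
  refine (norm_sum_le _ _).trans ?_
  refine (Finset.sum_le_card_nsmul _ _ a fun i _ => ?_).trans ?_
  · have h1 : g⁻¹ ^ i ≤ 1 := pow_le_one₀ (inv_nonneg.2 (by linarith))
      (inv_le_one_of_one_le₀ hg.le)
    have h2 : 0 ≤ g⁻¹ ^ i := pow_nonneg (inv_nonneg.2 (by linarith)) i
    rw [norm_smul, PiLp.norm_single, norm_one, mul_one, Real.norm_of_nonneg (by positivity)]
    nlinarith
  · simp

namespace ChainParams

variable {q : ChainParams} {a g : ℝ} {N T b : ℕ}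

/-- The parameters fit to the minimizer `chainMin a g q.n`. -/
structure Fits (q : ChainParams) (a g : ℝ) : Prop extends q.Valid where
  a_pos : 0 < a
  one_lt_g : 1 < g
  c_eq : q.c = a * g⁻¹ ^ q.n * (1 - g⁻¹)
  γ_eq : q.γ = q.β * (a * (g - 1) - q.c)
  m_eq : q.m = a
  β_eq : q.β * (g - 1) ^ 2 = q.lam * g
  le_K : q.τ + (q.slope + 1) * (q.R + 2 * ((q.n + 1) * a)) ≤ q.K

theorem Fits.c_pos (hq : q.Fits a g) : 0 < q.c := by
  have h1 := hq.one_lt_g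
  have h2 : g⁻¹ < 1 := inv_lt_one_of_one_lt₀ h1
  have h3 : 0 < g⁻¹ := inv_pos.2 (by linarith)
  rw [hq.c_eq]
  exact mul_pos (mul_pos hq.a_pos (pow_pos h3 _)) (by linarith)

variable {d : ℕ} {p : ℕ → Fin d}

theorem Fits.base_chainMin (hq : q.Fits a g) :
    q.base q.n p (chainMin a g q.n p) = q.chain q.n p (chainMin a g q.n p) - q.τ / 2 ∧
    q.baseGrad q.n p (chainMin a g q.n p)
      = chainGrad q.γ q.β q.c q.m q.n p (chainMin a g q.n p) := by
  refine hq.toValid.base_eq p (hq.toValid.le_chain_sub_wall p (le_trans ?_ hq.le_K))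
  have := norm_chainMin_le (n := q.n) hq.a_pos.le hq.one_lt_g p
  have := hq.toValid.slope_nonneg
  gcongr

theorem Fits.grad_chainMin (hq : q.Fits a g) (hp : Set.InjOn p (Finset.range (q.n + 1))) :
    q.grad q.n p (chainMin a g q.n p) = 0 := by
  rw [grad, hq.base_chainMin.2]
  exact chainGrad_chainMin hq.a_pos.le hq.one_lt_g hq.c_eq hq.β_eq hq.γ_eq hq.m_eq.ge hp

theorem Fits.risk_growth (hq : q.Fits a g) (hp : Set.InjOn p (Finset.range (q.n + 1)))
    (x : Euc d) :
    (q.objective p).risk (chainMin a g q.n p) + q.lam / 2 * ‖x - chainMin a g q.n p‖ ^ 2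
      ≤ (q.objective p).risk x := by
  rw [risk_objective]
  exact (hq.toValid.hasSmoothGrad_base hp).le_of_stationary (hq.grad_chainMin hp) x

theorem Fits.isMinOn (hq : q.Fits a g) (hp : Set.InjOn p (Finset.range (q.n + 1))) :
    IsMinOn (q.objective p).risk univ (chainMin a g q.n p) := by
  intro x _
  have h1 := hq.risk_growth hp x
  have h2 := mul_nonneg (half_pos one_pos).le
    (mul_nonneg hq.lam_nonneg (sq_nonneg ‖x - chainMin a g q.n p‖))
  simp only [mem_ofPred_eq]
  linarith

theorem Fits.risk_zero_sub_le (hq : q.Fits a g) (hp : Set.InjOn p (Finset.range (q.n + 1))) :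
    (q.objective p).risk 0 - (q.objective p).risk (chainMin a g q.n p)
      ≤ q.β * (g - 1) * a ^ 2 := by
  have h1 : q.base q.n p (0 : Euc d) = - (q.τ / 2) := by
    have h2 : q.chain q.n p (0 : Euc d) = 0 := chainFun_zero hq.c_nonneg
    rw [(hq.toValid.base_eq p (hq.toValid.le_chain_sub_wall p (le_trans ?_ hq.le_K))).1, h2]
    · ring
    · have := hq.toValid.slope_nonneg
      have := hq.a_pos
      rw [norm_zero]
      gcongr
      positivity
  rw [risk_objective]
  simp only [norm_zero, h1, hq.base_chainMin.1]
  have h2 := neg_chainFun_chainMin_le (p := p) (lam := q.lam) hq.a_pos.le hq.one_lt_g hq.c_eq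
    hq.β_nonneg hq.lam_nonneg hq.γ_eq hq.m_eq.ge hp
  unfold chain
  linarith

theorem Fits.inStronglyConvexClass (hq : q.Fits a g)
    (hp : Set.InjOn p (Finset.range (q.n + 1))) {H Δ σ : ℝ}
    (hH : 4 * q.β + (2 * (q.slope + 1)) ^ 2 / q.τ + q.lam ≤ H) (hΔ : q.β * (g - 1) * a ^ 2 ≤ Δ) :
    (q.objective p).InStronglyConvexClass H q.lam Δ σ := by
  refine ⟨fun z => ((hq.toValid.hasSmoothGrad_objective hp z).mono hH).isConvexSmooth, ?_,
    chainMin a g q.n p, hq.isMinOn hp, (hq.risk_zero_sub_le hp).trans hΔ, ?_⟩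
  · rw [risk_objective]
    exact (hq.toValid.hasSmoothGrad_base hp).strongConvexOn
  · have hz : ∀ z, ‖(q.objective p).lossGrad (chainMin a g q.n p) z‖ ^ 2 = 0 := by
      intro z
      have := (hq.toValid.lossGrad_objective hp (chainMin a g q.n p) z).trans (hq.grad_chainMin hp)
      simpa using this
    simp only [StochasticObjective.GradVarianceLE, hz]
    exact ⟨integrable_zero _ _ _, by simpa using sq_nonneg σ⟩

/-- A point whose coordinates to come are small, or which is far away, has a large error. -/
theorem Fits.le_risk_sub (hq : q.Fits a g) (hp : Set.InjOn p (Finset.range (q.n + 1)))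
    {x : Euc d} (hx : q.K ≤ ‖x‖ ∨ ∀ i, T ≤ i → i ≤ q.n → |x (p i)| ≤ q.c / 2) :
    q.lam / 8 * ∑ i ∈ Finset.Ico T (q.n + 1), (a * g⁻¹ ^ i) ^ 2
      ≤ (q.objective p).risk x - (q.objective p).optValue := by
  rw [StochasticObjective.optValue_eq (hq.isMinOn hp)]
  have h1 := hq.risk_growth hp x
  set w := chainMin a g q.n p with hw
  have hlam := hq.lam_nonneg
  have hsub : Finset.Ico T (q.n + 1) ⊆ Finset.range (q.n + 1) := by
    intro i hi; simp at hi ⊢; omega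
  have hp' : Set.InjOn p (Finset.Ico T (q.n + 1)) := hp.mono (by exact_mod_cast hsub)
  have hwi : ∀ i ∈ Finset.Ico T (q.n + 1), w (p i) = a * g⁻¹ ^ i := by
    intro i hi
    rw [Finset.mem_Ico] at hi
    exact chainMin_apply hp (by omega)
  have key : (∑ i ∈ Finset.Ico T (q.n + 1), (a * g⁻¹ ^ i) ^ 2) / 4 ≤ ‖x - w‖ ^ 2 := by
    rcases hx with hx | hx
    · have h2 : ∑ i ∈ Finset.Ico T (q.n + 1), (a * g⁻¹ ^ i) ^ 2 ≤ ‖w‖ ^ 2 := by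
        refine (le_of_eq (Finset.sum_congr rfl fun i hi => ?_)).trans (sum_sq_coord_le _ hp' w)
        rw [hwi i hi]
      have h3 : ‖w‖ ≤ (q.n + 1) * a := norm_chainMin_le hq.a_pos.le hq.one_lt_g p
      have h4 : 2 * ‖w‖ ≤ q.K := by
        have h5 := hq.le_K
        have h6 := hq.toValid.slope_nonneg
        have h7 := hq.τ_pos
        have h8 := hq.R_pos
        have h9 : 0 ≤ (q.n + 1) * a := (norm_nonneg _).trans h3
        nlinarith [mul_nonneg h6 h9, mul_nonneg h6 h8.le]
      have h5 : ‖w‖ ≤ ‖x - w‖ := by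
        have := norm_sub_norm_le x w
        linarith
      have h6 := pow_le_pow_left₀ (norm_nonneg w) h5 2
      nlinarith [sq_nonneg ‖w‖]
    · refine le_trans ?_ (sum_sq_coord_le _ hp' (x - w))
      rw [Finset.sum_div]
      refine Finset.sum_le_sum fun i hi => ?_
      have hi' := Finset.mem_Ico.1 hi
      have h2 := abs_le.1 (hx i hi'.1 (by omega))
      have e : (x - w) (p i) = x (p i) - a * g⁻¹ ^ i := by rw [← hwi i hi]; rfl
      rw [e]
      have hg := hq.one_lt_g
      have g0 : 0 < g⁻¹ := inv_pos.2 (by linarith)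
      have g1 : g⁻¹ ≤ 1 := inv_le_one_of_one_le₀ hg.le
      have h3 : q.c ≤ a * g⁻¹ ^ i := by
        rw [hq.c_eq]
        have ha := hq.a_pos
        calc a * g⁻¹ ^ q.n * (1 - g⁻¹) ≤ a * g⁻¹ ^ i * 1 := by
              have : g⁻¹ ^ q.n ≤ g⁻¹ ^ i := pow_le_pow_of_le_one g0.le g1 (by omega)
              gcongr
              linarith
          _ = _ := mul_one _
      have h4 : 0 ≤ a * g⁻¹ ^ i := hq.c_pos.le.trans h3
      nlinarith [h2.2]
  have := mul_le_mul_of_nonneg_left key (by positivity : 0 ≤ q.lam / 2)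
  linarith

/-- For every algorithm there is a placement of the chain for which its error is large. -/
theorem Fits.exists_place (hq : q.Fits a g) (hb : 0 < b) (hT : T ≤ q.n) {Q : ℕ}
    (hQ : q.K ^ 2 / (q.c / 2) ^ 2 ≤ Q) (hQ0 : 0 < Q) (hN : N = 2 * ((T + 1) * (q.n + 1) * Q))
    (A : FirstOrderAlgorithm.{u} ((q.n + 1) * N) T) :
    ∃ J : Fin (q.n + 1) → Fin N,
      ENNReal.ofReal (q.lam / 16 * ∑ i ∈ Finset.Ico T (q.n + 1), (a * g⁻¹ ^ i) ^ 2)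
        ≤ A.expectedError (q.objective (place J)) b := by
  set e := q.lam / 16 * ∑ i ∈ Finset.Ico T (q.n + 1), (a * g⁻¹ ^ i) ^ 2 with he
  have hN0 : 0 < N := by rw [hN]; positivity
  have : Nonempty (Fin N) := ⟨⟨0, hN0⟩⟩
  have key : ∃ J : Fin (q.n + 1) → Fin N, ENNReal.ofReal e *
      (A.seedDist.prod (Measure.pi fun _ : Fin T => Measure.pi
        fun _ : Fin b => Measure.dirac ())) univ
      ≤ A.expectedError (q.objective (place J)) b := by
    refine exists_mul_measure_le_lintegral (κ := Fin (q.n + 1) → Fin N)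
      (μ := A.seedDist.prod (Measure.pi fun _ : Fin T => Measure.pi
        fun _ : Fin b => Measure.dirac ()))
      (f := fun J ω => ENNReal.ofReal ((q.objective (place J)).risk
        (A.result (q.objective (place J)) ω.1 ω.2) - (q.objective (place J)).optValue)) ?_ ?_
    · intro J
      have hg : Measurable (Function.uncurry (q.objective (place J)).lossGrad) := by
        refine measurable_from_prod_countable_left (β := Unit) fun z => ?_
        simp only [Function.uncurry, hq.toValid.lossGrad_objective (place_injOn J)]
        exact measurable_grad _ _
      have h3 : Measurable (q.objective (place J)).risk := by
        rw [risk_objective]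
        have := measurable_base (q := q) q.n (place J)
        fun_prop
      exact ((h3.comp (FirstOrderAlgorithm.measurable_result hg)).sub_const _).ennreal_ofReal
    · intro ω _
      have h1 := card_le_two_mul_wellHidden (A := A) (s := ω.1) hq.c_pos hQ hQ0 hN
      have h2 : ∀ J ∈ q.wellHidden A ω.1, ENNReal.ofReal (2 * e) ≤
          ENNReal.ofReal ((q.objective (place J)).risk
        (A.result (q.objective (place J)) ω.1 ω.2) - (q.objective (place J)).optValue) := by
        intro J hJ
        apply ENNReal.ofReal_le_ofReal
        rw [hq.toValid.result_eq_hiddenPoint hb hT hJ]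
        refine le_trans (le_of_eq ?_)
          (hq.le_risk_sub (place_injOn J) (small_of_wellHidden hJ le_rfl))
        rw [he]; ring
      calc (Fintype.card (Fin (q.n + 1) → Fin N) : ENNReal) * ENNReal.ofReal e
          ≤ ((2 * (q.wellHidden A ω.1).card : ℕ) : ENNReal) * ENNReal.ofReal e := by
            gcongr
        _ = (q.wellHidden A ω.1).card • ENNReal.ofReal (2 * e) := by
            rw [ENNReal.ofReal_mul (p := 2) (by norm_num), nsmul_eq_mul]
            push_cast
            rw [ENNReal.ofReal_ofNat]
            ring
        _ ≤ ∑ J ∈ q.wellHidden A ω.1, ENNReal.ofReal ((q.objective (place J)).risk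
            (A.result (q.objective (place J)) ω.1 ω.2) - (q.objective (place J)).optValue) :=
            Finset.card_nsmul_le_sum _ _ _ h2
        _ ≤ _ := Finset.sum_le_sum_of_subset (Finset.subset_univ _)
  simpa using key

end ChainParams

/-- Lower bound for noiseless gradients. -/
theorem exists_chain_hard {H lam g β Δ : ℝ} {T b : ℕ} (hb : 0 < b) (hg : 1 < g) (hlam : 0 < lam)
    (hβ : β * (g - 1) ^ 2 = lam * g) (hH : 4 * β + lam < H) (hΔ : 0 < Δ) :
    ∃ d : ℕ, 0 < d ∧ ∀ A : FirstOrderAlgorithm.{u} d T, ∃ P : StochasticObjective d,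
      (∀ σ, P.InStronglyConvexClass H lam Δ σ) ∧
      ENNReal.ofReal (Δ / 64 * g⁻¹ ^ (2 * T)) ≤ A.expectedError P b := by
  have hg1 : 0 < g - 1 := by linarith
  have g0 : 0 < g⁻¹ := inv_pos.2 (by linarith)
  have g1 : g⁻¹ < 1 := inv_lt_one_of_one_lt₀ hg
  have hβ0 : 0 < β := by
    have : 0 < β * (g - 1) ^ 2 := by rw [hβ]; positivity
    exact pos_of_mul_pos_left this (by positivity)
  obtain ⟨L, hL⟩ := exists_pow_lt_of_lt_one (show (0 : ℝ) < 1 / 2 by norm_num)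
    (show g⁻¹ ^ 2 < 1 from pow_lt_one₀ g0.le g1 two_ne_zero)
  set a := √(Δ / (β * (g - 1))) with ha
  have ha0 : 0 < a := Real.sqrt_pos.2 (by positivity)
  have ha2 : β * (g - 1) * a ^ 2 = Δ := by
    rw [ha, Real.sq_sqrt (by positivity)]; field_simp
  set n := T + L with hn
  set c := a * g⁻¹ ^ n * (1 - g⁻¹) with hc
  set γ := β * (a * (g - 1) - c) with hγ
  set G := |γ| + 2 * β * a * n with hG
  have hG0 : 0 ≤ G := by positivity
  have hs : 0 < H - lam - 4 * β := by linarith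
  set τ := (2 * (G + 1)) ^ 2 / (H - lam - 4 * β) with hτ
  set R := (G + 1) / (4 * β) with hR
  set q : ChainParams := ⟨γ, β, c, a, τ, R, τ + (G + 1) * (R + 2 * ((n + 1) * a)), lam, n⟩ with hq
  have hτ0 : 0 < τ := by positivity
  have hc0 : 0 ≤ c := mul_nonneg (by positivity) (by linarith)
  have hfit : q.Fits a g :=
    { β_nonneg := hβ0.le
      m_nonneg := ha0.le
      c_nonneg := hc0
      lam_nonneg := hlam.le
      τ_pos := hτ0
      R_pos := by positivity
      slope_le := by
        change (G + 1) / R ≤ 4 * β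
        rw [hR]
        apply le_of_eq
        field_simp
      a_pos := ha0
      one_lt_g := hg
      c_eq := rfl
      γ_eq := rfl
      m_eq := rfl
      β_eq := hβ
      le_K := le_rfl }
  obtain ⟨Q, hQ⟩ := exists_nat_ge (q.K ^ 2 / (q.c / 2) ^ 2)
  have hQ' : q.K ^ 2 / (q.c / 2) ^ 2 ≤ ((Q + 1 : ℕ) : ℝ) := hQ.trans (by push_cast; linarith)
  refine ⟨(q.n + 1) * (2 * ((T + 1) * (q.n + 1) * (Q + 1))), by positivity, fun A => ?_⟩
  obtain ⟨J, hJ⟩ := hfit.exists_place hb (Nat.le_add_right T L) hQ' Q.succ_pos rfl A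
  refine ⟨q.objective (place J), fun σ =>
    hfit.inStronglyConvexClass (place_injOn J) ?_ ha2.le, le_trans ?_ hJ⟩
  · change 4 * β + (2 * (G + 1)) ^ 2 / τ + lam ≤ H
    have : (2 * (G + 1)) ^ 2 / τ = H - lam - 4 * β := by
      rw [hτ]; field_simp
    rw [this]; linarith
  · apply ENNReal.ofReal_le_ofReal
    change Δ / 64 * g⁻¹ ^ (2 * T) ≤ lam / 16 * ∑ i ∈ Finset.Ico T (T + L + 1), (a * g⁻¹ ^ i) ^ 2
    have h1 : a ^ 2 * (g⁻¹ ^ (2 * T) * ∑ i ∈ Finset.range L, (g⁻¹ ^ 2) ^ i)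
        ≤ ∑ i ∈ Finset.Ico T (T + L + 1), (a * g⁻¹ ^ i) ^ 2 := by
      calc a ^ 2 * (g⁻¹ ^ (2 * T) * ∑ i ∈ Finset.range L, (g⁻¹ ^ 2) ^ i)
          = ∑ i ∈ Finset.range L, (a * g⁻¹ ^ (T + i)) ^ 2 := by
            rw [Finset.mul_sum, Finset.mul_sum]
            refine Finset.sum_congr rfl fun i _ => ?_
            ring
        _ = ∑ i ∈ Finset.Ico T (T + L), (a * g⁻¹ ^ i) ^ 2 := by
            rw [Finset.sum_Ico_eq_sum_range, Nat.add_sub_cancel_left]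
        _ ≤ _ := Finset.sum_le_sum_of_subset_of_nonneg
            (Finset.Ico_subset_Ico_right (Nat.le_succ _)) fun _ _ _ => sq_nonneg _
    have h2 : 1 / 2 / (1 - g⁻¹ ^ 2) ≤ ∑ i ∈ Finset.range L, (g⁻¹ ^ 2) ^ i := by
      have hlt : g⁻¹ ^ 2 < 1 := pow_lt_one₀ g0.le g1 two_ne_zero
      have e : ∑ i ∈ Finset.range L, (g⁻¹ ^ 2) ^ i = (1 - (g⁻¹ ^ 2) ^ L) / (1 - g⁻¹ ^ 2) := by
        rw [geom_sum_eq hlt.ne, ← neg_div_neg_eq, neg_sub, neg_sub]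
      rw [e]
      exact div_le_div_of_nonneg_right (by linarith) (by linarith)
    have h3 : Δ / 64 ≤ lam / 16 * (a ^ 2 * (1 / 2 / (1 - g⁻¹ ^ 2))) := by
      have hlt : g⁻¹ ^ 2 < 1 := pow_lt_one₀ g0.le g1 two_ne_zero
      have e : lam / 16 * (a ^ 2 * (1 / 2 / (1 - g⁻¹ ^ 2))) = Δ * (g / (32 * (g + 1))) := by
        have e1 : lam = β * (g - 1) ^ 2 / g := by rw [hβ]; field_simp
        have e2 : 1 - g⁻¹ ^ 2 = (g - 1) * (g + 1) / g ^ 2 := by field_simp; ring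
        rw [e1, e2, ← ha2]
        field_simp
        ring
      have h4 : (1 : ℝ) / 64 ≤ g / (32 * (g + 1)) := by
        rw [div_le_div_iff₀ (by norm_num) (by positivity)]
        linarith
      rw [e]
      nlinarith
    calc Δ / 64 * g⁻¹ ^ (2 * T)
        ≤ lam / 16 * (a ^ 2 * (1 / 2 / (1 - g⁻¹ ^ 2))) * g⁻¹ ^ (2 * T) := by gcongr
      _ = lam / 16 * (a ^ 2 * (g⁻¹ ^ (2 * T) * (1 / 2 / (1 - g⁻¹ ^ 2)))) := by ring
      _ ≤ lam / 16 * (a ^ 2 * (g⁻¹ ^ (2 * T) * ∑ i ∈ Finset.range L, (g⁻¹ ^ 2) ^ i)) := by gcongr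
      _ ≤ _ := by gcongr

/-- Lower bound with the accelerated rate, for noiseless gradients. -/
theorem exists_accelerated_hard {κ₀ : ℝ} (hκ : 1 < κ₀) : ∃ c' : ℝ, 0 < c' ∧
    ∀ (H lam Δ : ℝ) (b T : ℕ), 0 < lam → κ₀ * lam ≤ H → 0 < Δ → 0 < b →
      ∃ d : ℕ, 0 < d ∧ ∀ A : FirstOrderAlgorithm.{u} d T, ∃ P : StochasticObjective d,
        (∀ σ, P.InStronglyConvexClass H lam Δ σ) ∧
        ENNReal.ofReal (Δ / 64 * Real.exp (-(c' * √lam * T / √H))) ≤ A.expectedError P b := by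
  have hκ' : 0 < 1 - κ₀⁻¹ := by
    have := inv_lt_one_of_one_lt₀ hκ
    linarith
  set θ : ℝ := 1 + 8 / (1 - κ₀⁻¹) with hθ
  have hθ1 : 1 ≤ θ := by
    have : 0 < 8 / (1 - κ₀⁻¹) := by positivity
    linarith
  have hθ8 : 8 / θ < 1 - κ₀⁻¹ := by
    rw [div_lt_iff₀ (by linarith), hθ, mul_add, mul_div_cancel₀ _ hκ'.ne']
    linarith
  refine ⟨2 * θ, by linarith, fun H lam Δ b T hlam hH hΔ hb => ?_⟩
  have hH0 : 0 < H := lt_of_lt_of_le (by positivity) hH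
  set x := √lam / √H with hx
  have hx0 : 0 < x := div_pos (Real.sqrt_pos.2 hlam) (Real.sqrt_pos.2 hH0)
  have hx2 : x ^ 2 = lam / H := by
    rw [hx, div_pow, Real.sq_sqrt hlam.le, Real.sq_sqrt hH0.le]
  have hxκ : lam / H ≤ κ₀⁻¹ := by
    rw [div_le_iff₀ hH0, inv_mul_eq_div, le_div_iff₀ (by linarith)]
    linarith
  have hx1 : x ≤ 1 := by
    have : x ^ 2 ≤ 1 := by rw [hx2]; linarith
    nlinarith
  set g := 1 + θ * x with hg
  have hg1 : 1 < g := by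
    have : 0 < θ * x := by positivity
    linarith
  have hβ : g * H / θ ^ 2 * (g - 1) ^ 2 = lam * g := by
    have : (g - 1) ^ 2 = θ ^ 2 * (lam / H) := by rw [hg, ← hx2]; ring
    rw [this]
    field_simp
  have hlt : 4 * (g * H / θ ^ 2) + lam < H := by
    have h1 : g ≤ 2 * θ := by nlinarith
    have h2 : 4 * (g * H / θ ^ 2) ≤ 8 / θ * H := by
      calc 4 * (g * H / θ ^ 2) ≤ 4 * (2 * θ * H / θ ^ 2) := by gcongr
        _ = 8 / θ * H := by field_simp; ring
    have h3 : lam ≤ κ₀⁻¹ * H := by rwa [div_le_iff₀ hH0] at hxκ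
    nlinarith [mul_lt_mul_of_pos_right hθ8 hH0]
  obtain ⟨d, hd, h⟩ := exists_chain_hard.{u} (T := T) hb hg1 hlam hβ hlt hΔ
  refine ⟨d, hd, fun A => ?_⟩
  obtain ⟨P, hP1, hP2⟩ := h A
  refine ⟨P, hP1, le_trans (ENNReal.ofReal_le_ofReal ?_) hP2⟩
  refine mul_le_mul_of_nonneg_left ?_ (by positivity)
  have h1 : Real.exp (-(θ * x)) ≤ g⁻¹ := by
    rw [Real.exp_neg]
    have := Real.add_one_le_exp (θ * x)
    exact inv_anti₀ (by linarith) (by linarith)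
  calc Real.exp (-(2 * θ * √lam * T / √H)) = Real.exp (-(θ * x)) ^ (2 * T) := by
        rw [← Real.exp_nat_mul, hx]
        congr 1
        push_cast
        ring
    _ ≤ g⁻¹ ^ (2 * T) := pow_le_pow_left₀ (Real.exp_pos _).le h1 _

theorem exists_convex_interpolation_hard {d T b : ℕ} (hd : 0 < d) (hb : 0 < b) (hT : 0 < T)
    (A : FirstOrderAlgorithm.{u} d T) {H B σ : ℝ} (hH : 0 < H) (hB : 0 < B) :
    ∃ P : StochasticObjective d, P.InConvexClass H B σ ∧
      ENNReal.ofReal (H * B ^ 2 / (b * T) / 16) ≤ A.expectedError P b := by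
  have hn : (0 : ℝ) < b * T := by positivity
  have hlam : 0 < H / (2 * (b * T)) := by positivity
  obtain ⟨P, h1, h2⟩ := exists_interpolation_hard hd hb hT A hH
    (Δ := H / (2 * (b * T)) * B ^ 2 / 4) (lam := H / (2 * (b * T))) (by positivity)
    (le_of_eq (by field_simp)) hlam (σ := σ)
  have : 0 < H / (2 * (b * T)) * B ^ 2 := by positivity
  refine ⟨P, h1.inConvexClass hlam hB (by linarith),
    le_trans (ENNReal.ofReal_le_ofReal (le_of_eq ?_)) h2⟩
  field_simp
  norm_num

theorem exists_convex_noise_hard {d T b : ℕ} (hd : 0 < d) (hb : 0 < b) (hT : 0 < T)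
    (A : FirstOrderAlgorithm.{u} d T) {H B σ : ℝ} (hH : 0 < H) (hB : 0 < B) (hσ : 0 < σ) :
    ∃ P : StochasticObjective d, P.InConvexClass H B σ ∧
      ENNReal.ofReal (min (σ * B / √((b : ℝ) * T)) (H * B ^ 2) / 32) ≤ A.expectedError P b := by
  have hn : (0 : ℝ) < b * T := by positivity
  set r := √((b : ℝ) * T) with hr
  have hr0 : 0 < r := Real.sqrt_pos.2 hn
  have hr2 : (b : ℝ) * T = r ^ 2 := (Real.sq_sqrt hn.le).symm
  set lam := min (σ / (B * r)) H with hl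
  have hlam : 0 < lam := lt_min (by positivity) hH
  have e : min (σ * B / r) (H * B ^ 2) = lam * B ^ 2 := by
    rw [hl, min_mul_of_nonneg _ _ (by positivity)]
    congr 1
    field_simp
  obtain ⟨P, h1, h2⟩ := exists_noise_hard hd hb hT A (H := H) (Δ := lam * B ^ 2 / 4) (lam := lam)
    (σ := σ) (by positivity) (min_le_right _ _) hlam
  have hpos : 0 < lam * B ^ 2 := by positivity
  refine ⟨P, h1.inConvexClass hlam hB (by linarith),
    le_trans (ENNReal.ofReal_le_ofReal (le_of_eq ?_)) h2⟩
  have h3 : lam * B ^ 2 / 4 ≤ σ ^ 2 / (lam * (b * T)) := by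
    have h4 : lam * B * r ≤ σ := by
      have := min_le_left (σ / (B * r)) H
      rw [← hl, le_div_iff₀ (by positivity)] at this
      linarith
    rw [hr2, le_div_iff₀ (by positivity)]
    have h5 := pow_le_pow_left₀ (by positivity) h4 2
    nlinarith [sq_nonneg (lam * B * r)]
  rw [min_eq_right h3, e]
  ring

theorem exists_convex_accelerated_hard : ∃ c : ℝ, 0 < c ∧ c ≤ 1 / 32 ∧
    ∀ (H B : ℝ) (b T : ℕ), 0 < H → 0 < B → 0 < b → 0 < T →
      ∃ d : ℕ, 0 < d ∧ ∀ A : FirstOrderAlgorithm.{u} d T, ∃ P : StochasticObjective d,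
        (∀ σ, P.InConvexClass H B σ) ∧
        ENNReal.ofReal (c * (H * B ^ 2 / (T : ℝ) ^ 2)) ≤ A.expectedError P b := by
  obtain ⟨c', hc', h⟩ := exists_accelerated_hard.{u} (κ₀ := 2) one_lt_two
  have h1 : Real.exp (-c') ≤ 1 := Real.exp_le_one_iff.2 (by linarith)
  refine ⟨Real.exp (-c') / 512, by positivity, by linarith, fun H B b T hH hB hb hT => ?_⟩
  have hT1 : (1 : ℝ) ≤ T := by exact_mod_cast hT
  have hlam : 0 < H / (2 * (T : ℝ) ^ 2) := by positivity
  have hpos : 0 < H / (2 * (T : ℝ) ^ 2) * B ^ 2 := by positivity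
  obtain ⟨d, hd, h⟩ := h H (H / (2 * (T : ℝ) ^ 2)) (H / (2 * (T : ℝ) ^ 2) * B ^ 2 / 4) b T hlam
    (by
      have : 2 * (H / (2 * (T : ℝ) ^ 2)) = H / (T : ℝ) ^ 2 := by field_simp
      rw [this]
      exact div_le_self hH.le (one_le_pow₀ hT1)) (by positivity) hb
  refine ⟨d, hd, fun A => ?_⟩
  obtain ⟨P, h2, h3⟩ := h A
  refine ⟨P, fun σ => (h2 σ).inConvexClass hlam hB (by linarith),
    le_trans (ENNReal.ofReal_le_ofReal ?_) h3⟩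
  have h4 : √(H / (2 * (T : ℝ) ^ 2)) * T ≤ √H := by
    rw [Real.sqrt_div hH.le, div_mul_eq_mul_div, div_le_iff₀ (Real.sqrt_pos.2 (by positivity))]
    refine mul_le_mul_of_nonneg_left ?_ (Real.sqrt_nonneg _)
    exact Real.le_sqrt_of_sq_le (by nlinarith)
  have h5 : Real.exp (-c') ≤ Real.exp (-(c' * √(H / (2 * (T : ℝ) ^ 2)) * T / √H)) := by
    apply Real.exp_le_exp.2
    rw [neg_le_neg_iff, div_le_iff₀ (Real.sqrt_pos.2 hH), mul_assoc]
    exact mul_le_mul_of_nonneg_left h4 hc'.le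
  have e : Real.exp (-c') / 512 * (H * B ^ 2 / (T : ℝ) ^ 2)
      = H / (2 * (T : ℝ) ^ 2) * B ^ 2 / 4 / 64 * Real.exp (-c') := by
    field_simp
    norm_num
  rw [e]
  exact mul_le_mul_of_nonneg_left h5 (by positivity)

theorem corollary3 :
    -- convex lower bound
    (∃ c : ℝ, 0 < c ∧
      ∀ (H B σ : ℝ) (b T : ℕ), 0 < H → 0 < B → 0 ≤ σ → 0 < b → 0 < T →
        ∃ d : ℕ, ∀ A : FirstOrderAlgorithm.{u} d T, ∃ P : StochasticObjective d,
          P.InConvexClass H B σ ∧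
          ENNReal.ofReal (c * (H * B ^ 2 / (T : ℝ) ^ 2 + H * B ^ 2 / ((b : ℝ) * T)
              + min (σ * B / √((b : ℝ) * T)) (H * B ^ 2)))
            ≤ A.expectedError P b) ∧
    -- strongly convex lower bound
    (∀ κ₀ : ℝ, 1 < κ₀ → ∃ c c' : ℝ, 0 < c ∧ 0 < c' ∧
      ∀ (H lam Δ σ : ℝ) (b T : ℕ), 0 < lam → κ₀ * lam ≤ H → 0 < Δ → 0 ≤ σ → 0 < b → 0 < T →
        ∃ d : ℕ, ∀ A : FirstOrderAlgorithm.{u} d T, ∃ P : StochasticObjective d,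
          P.InStronglyConvexClass H lam Δ σ ∧
          ENNReal.ofReal (c * (Δ * Real.exp (-(c' * √lam * T / √H))
              + Δ * (if (b : ℝ) * T ≤ H / (2 * lam) then 1 else 0)
              + min (σ ^ 2 / (lam * ((b : ℝ) * T))) Δ))
            ≤ A.expectedError P b) ∧
    -- no accelerated rate with minibatches of size one, even if the gradient noise vanishes at the
    -- optimum: convex case
    (∀ C : ℝ, 0 < C → ∃ T₀ : ℕ, ∀ T : ℕ, T₀ ≤ T → ∀ H B : ℝ, 0 < H → 0 < B →
        ∃ d : ℕ, ∀ A : FirstOrderAlgorithm.{u} d T, ∃ P : StochasticObjective d,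
          P.InConvexClass H B 0 ∧
          ENNReal.ofReal (C * (H * B ^ 2 / (T : ℝ) ^ 2)) < A.expectedError P 1) ∧
    -- the same in the strongly convex case
    (∀ C a : ℝ, 0 < C → 0 < a → ∃ κ₁ : ℝ, ∀ H lam Δ : ℝ, 0 < lam → κ₁ * lam ≤ H → 0 < Δ →
        ∃ T : ℕ, 0 < T ∧
        ∃ d : ℕ, ∀ A : FirstOrderAlgorithm.{u} d T, ∃ P : StochasticObjective d,
          P.InStronglyConvexClass H lam Δ 0 ∧
          ENNReal.ofReal (C * Δ * Real.exp (-(a * √lam * T / √H))) < A.expectedError P 1) := by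
  refine ⟨?_, ?_, ?_, ?_⟩
  · obtain ⟨c, hc0, hc, h⟩ := exists_convex_accelerated_hard.{u}
    refine ⟨c / 3, by positivity, fun H B σ b T hH hB hσ hb hT => ?_⟩
    obtain ⟨d, hd, h⟩ := h H B b T hH hB hb hT
    refine ⟨d, fun A => ?_⟩
    set t₁ := H * B ^ 2 / (T : ℝ) ^ 2 with ht₁
    set t₂ := H * B ^ 2 / ((b : ℝ) * T) with ht₂
    set t₃ := min (σ * B / √((b : ℝ) * T)) (H * B ^ 2) with ht₃
    have p₁ : 0 < t₁ := by positivity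
    have p₂ : 0 < t₂ := by positivity
    by_cases h₁ : t₂ ≤ t₁ ∧ t₃ ≤ t₁
    · obtain ⟨P, hP, hP'⟩ := h A
      refine ⟨P, hP σ, le_trans (ENNReal.ofReal_le_ofReal ?_) hP'⟩
      nlinarith
    by_cases h₂ : t₃ ≤ t₂
    · obtain ⟨P, hP, hP'⟩ := exists_convex_interpolation_hard hd hb hT A hH hB (σ := σ)
      refine ⟨P, hP, le_trans (ENNReal.ofReal_le_ofReal ?_) hP'⟩
      have : t₁ ≤ t₂ := by
        by_contra! h'
        exact h₁ ⟨h'.le, h₂.trans h'.le⟩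
      nlinarith
    · have h₃ : t₁ ≤ t₃ := by
        by_contra! h'
        exact h₁ ⟨(not_le.1 h₂).le.trans h'.le, h'.le⟩
      have hσ0 : 0 < σ := by
        rcases hσ.eq_or_lt with h' | h'
        · rw [ht₃, ← h', zero_mul, zero_div] at h₃
          linarith [min_le_left 0 (H * B ^ 2)]
        · exact h'
      obtain ⟨P, hP, hP'⟩ := exists_convex_noise_hard hd hb hT A hH hB hσ0
      refine ⟨P, hP, le_trans (ENNReal.ofReal_le_ofReal ?_) hP'⟩
      nlinarith
  · intro κ₀ hκ
    obtain ⟨c', hc', h⟩ := exists_accelerated_hard.{u} hκ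
    refine ⟨1 / 192, c', by norm_num, hc', fun H lam Δ σ b T hlam hH hΔ hσ hb hT => ?_⟩
    obtain ⟨d, hd, h⟩ := h H lam Δ b T hlam hH hΔ hb
    refine ⟨d, fun A => ?_⟩
    have hlamH : lam ≤ H := by nlinarith
    set t₁ := Δ * Real.exp (-(c' * √lam * T / √H)) with ht₁
    set t₂ := Δ * (if (b : ℝ) * T ≤ H / (2 * lam) then 1 else 0) with ht₂
    set t₃ := min (σ ^ 2 / (lam * ((b : ℝ) * T))) Δ with ht₃
    have p₁ : 0 < t₁ := by positivity
    by_cases h₁ : t₂ ≤ t₁ ∧ t₃ ≤ t₁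
    · obtain ⟨P, hP, hP'⟩ := h A
      refine ⟨P, hP σ, le_trans (ENNReal.ofReal_le_ofReal ?_) hP'⟩
      have e : Δ / 64 * Real.exp (-(c' * √lam * T / √H)) = t₁ / 64 := by rw [ht₁]; ring
      rw [e]
      linarith
    by_cases h₂ : t₃ ≤ t₂
    · have h₃ : t₁ ≤ t₂ := by
        by_contra! h'
        exact h₁ ⟨h'.le, h₂.trans h'.le⟩
      have hn : (b : ℝ) * T ≤ H / (2 * lam) := by
        by_contra h'
        rw [ht₂, if_neg h', mul_zero] at h₃
        linarith
      have e : t₂ = Δ := by rw [ht₂, if_pos hn, mul_one]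
      obtain ⟨P, hP, hP'⟩ := exists_interpolation_hard hd hb hT A (hlam.trans_le hlamH) hΔ hn hlam
        (σ := σ)
      refine ⟨P, hP, le_trans (ENNReal.ofReal_le_ofReal ?_) hP'⟩
      linarith
    · have h₃ : t₁ ≤ t₃ := by
        by_contra! h'
        exact h₁ ⟨(not_le.1 h₂).le.trans h'.le, h'.le⟩
      obtain ⟨P, hP, hP'⟩ := exists_noise_hard hd hb hT A hΔ hlamH hlam (σ := σ)
      refine ⟨P, hP, le_trans (ENNReal.ofReal_le_ofReal ?_) hP'⟩
      linarith
  · intro C hC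
    obtain ⟨T₀, hT₀⟩ := exists_nat_gt (16 * C)
    refine ⟨T₀, fun T hT H B hH hB => ⟨1, fun A => ?_⟩⟩
    have hTC : 16 * C < T := hT₀.trans_le (by exact_mod_cast hT)
    have hT0 : (0 : ℝ) < T := by linarith
    obtain ⟨P, hP, hP'⟩ := exists_convex_interpolation_hard one_pos one_pos
      (by exact_mod_cast hT0) A hH hB (σ := 0)
    refine ⟨P, hP, lt_of_lt_of_le ((ENNReal.ofReal_lt_ofReal_iff (by positivity)).2 ?_) hP'⟩
    have e : H * B ^ 2 / (((1 : ℕ) : ℝ) * T) / 16 = T / 16 * (H * B ^ 2 / (T : ℝ) ^ 2) := by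
      push_cast
      field_simp
    rw [e]
    exact mul_lt_mul_of_pos_right (by linarith) (by positivity)
  · intro C a hC ha
    refine ⟨max 4 ((8 * C / a) ^ 2), fun H lam Δ hlam hH hΔ => ?_⟩
    have hκ : max 4 ((8 * C / a) ^ 2) ≤ H / lam := (le_div_iff₀ hlam).2 hH
    have h4 : 4 ≤ H / lam := (le_max_left _ _).trans hκ
    have h8 : (8 * C / a) ^ 2 ≤ H / lam := (le_max_right _ _).trans hκ
    have hH0 : 0 < H := by
      rw [le_div_iff₀ hlam] at h4
      linarith
    have e2 : H / (2 * lam) = H / lam / 2 := by field_simp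
    set T := ⌊H / (2 * lam)⌋₊ with hT
    have hT1 : (T : ℝ) ≤ H / (2 * lam) := Nat.floor_le (by positivity)
    have hT2 : H / lam / 4 ≤ T := by
      have := Nat.lt_floor_add_one (H / (2 * lam))
      rw [← hT] at this
      linarith
    have hT0 : 0 < T := by
      have : (0 : ℝ) < T := by linarith
      exact_mod_cast this
    refine ⟨T, hT0, 1, fun A => ?_⟩
    obtain ⟨P, hP, hP'⟩ := exists_interpolation_hard one_pos one_pos hT0 A hH0 hΔ
      (by rw [Nat.cast_one, one_mul]; exact hT1) hlam (σ := 0)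
    refine ⟨P, hP, lt_of_lt_of_le ((ENNReal.ofReal_lt_ofReal_iff (by positivity)).2 ?_) hP'⟩
    set x := √H / √lam with hx
    have hsl : 0 < √lam := Real.sqrt_pos.2 hlam
    have hsH : 0 < √H := Real.sqrt_pos.2 hH0
    have hx0 : 0 < x := by positivity
    have hx2 : x ^ 2 = H / lam := by
      rw [hx, div_pow, Real.sq_sqrt hlam.le, Real.sq_sqrt hH0.le]
    have hxC : 8 * C / a ≤ x := by
      rw [← hx2] at h8
      exact le_of_sq_le_sq h8 hx0.le
    set y := a * √lam * T / √H with hy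
    have hy' : 2 * C ≤ y := by
      have e : y = a * T / x := by rw [hy, hx]; field_simp
      rw [e, le_div_iff₀ hx0]
      rw [div_le_iff₀ ha] at hxC
      rw [← hx2] at hT2
      nlinarith [mul_le_mul_of_nonneg_left hT2 ha.le, mul_le_mul_of_nonneg_right hxC hx0.le]
    have hexp : 2 * C < Real.exp y := by
      have := Real.add_one_le_exp y
      linarith
    rw [Real.exp_neg]
    have : C * (Real.exp y)⁻¹ < 1 / 2 := by
      rw [← div_eq_mul_inv, div_lt_iff₀ (Real.exp_pos y)]
      linarith
    calc C * Δ * (Real.exp y)⁻¹ = Δ * (C * (Real.exp y)⁻¹) := by ring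
      _ < Δ * (1 / 2) := mul_lt_mul_of_pos_left this hΔ
      _ = Δ / 2 := by ring
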